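/- **Definitions.** Let $G$ be a group and $Q\subset G$ a conjugacy class of involutions. For $i\ne j$ in $Q$ put $\ell_{ij}=\{k\in Q: ij\in kQ\}$, and write $x^g=g^{-1}xg$. We say that $Q$ *forms a mock hyperbolic reflection space* if, with $\Lambda=\{\ell_{ij}: i\neq j\in Q\}$ (a $G$-invariant family of subsets of $Q$, each with at least two elements), the following hold: (a) $\lambda=\ell_{ij}$ for all $\lambda\in\Lambda$ and $i\ne j$ in $\lambda$; (b) for all $i,j\in Q$ there is a unique $k\in Q$ with $i^k=j$; (c) if $\lambda\in\Lambda$ and $\lambda^i=\lambda^j$ for some $i\neq j$ in $Q$, then $\lambda^i=\lambda=\lambda^j$. A group $G$ acting on a set $X$ with $|X|\ge 2$ is *sharply $2$-transitive* if it acts regularly on ordered pairs of distinct points of $X$. Let $J$ be its set of involutions. Put $\mathrm{char}(G)=2$ if involutions have no fixed point in $X$; otherwise $\mathrm{char}(G)$ is the common order of the nontrivial products $ij$ with $i,j\in J$, where infinite order is recorded as $0$. A *near-field* is a set $K$ with a group structure $(K,+,0)$ and a multiplication such that $(K\setminus\{0\},\cdot,1)$ is a group, $0\cdot x=x\cdot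 0=0$, and $a(b+c)=ab+ac$. Its characteristic is the additive order of $1$ (or $0$ if this is infinite). It is *planar* if for all $a\neq b$ and $c$ in $K$ the equation $ax=bx+c$ has a unique solution $x$. A sharply $2$-transitive group is *the split sharply $2$-transitive group corresponding to $K$* if it is isomorphic, as a permutation group, to the group of all maps $z\mapsto b+az$ ($a\ne0$) on $K$. A *maximal near-field* of a sharply $2$-transitive group $G$ is a near-field $K$ such that for some $i\neq j$ in $J$ the normalizer $N_G(\ell_{ij})$ (with $\ell_{ij}$ formed with respect to $Q=J$), acting on $\ell_{ij}$ by conjugation, is the split sharply $2$-transitive group corresponding to $K$; it is unique up to isomorphism. "The maximal near-field of $G$ is planar" means that every such $K$ is planar; existence of $K$ is not assumed. $G$ satisfies the *descending chain condition for centralizers* if every descending sequence $C_G(A_0)\ge C_G(A_1)\ge\cdots$ of centralizers of subsets of $G$ is eventually constant. $G$ is *of finite Morley rank* if it carries a first-order structure in which its multiplication is definable (with parameters) and which has finite Morley rank. **Statement.** Let $G$ be a sharply $2$-transitive group. Then the set $J\subset G$ of involutions forms a mock hyperbolic reflection space in each of the following cases: 1. $G$ is the split sharply $2$-transitive group corresponding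 to a planar near-field of characteristic $\neq 2$; 2. $\mathrm{char}(G)=p$ with $p\neq 0,2$, and the maximal near-field of $G$ is planar; 3. $\mathrm{char}(G)=0$, $G$ satisfies the descending chain condition for centralizers, and the maximal near-field of $G$ is planar. In particular, if $\mathrm{char}(G)\ne 2$ and $G$ is of finite Morley rank, then $J$ forms a mock hyperbolic reflection space. -/

import Mathlib

universe u v w a b

/-! ### Mock hyperbolic reflection spaces -/

/-- The set of involutions of a group. -/
def involutions (G : Type*) [Group G] : Set G := {g | g ≠ 1 ∧ g * g = 1}

/-- `S ^ g = g⁻¹ S g`. -/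
def conjSet {G : Type*} [Group G] (S : Set G) (g : G) : Set G :=
  (fun s => g⁻¹ * s * g) '' S

/-- `ℓ_{ij} = {k ∈ Q : ij ∈ kQ}`. -/
def lineThrough {G : Type*} [Group G] (Q : Set G) (i j : G) : Set G :=
  {k | k ∈ Q ∧ ∃ q ∈ Q, i * j = k * q}

/-- `(Q, Λ)` is a partial mock hyperbolic reflection space in `G`. -/
structure IsPartialMockHyperbolic {G : Type*} [Group G] (Q : Set G) (Λ : Set (Set G)) :
    Prop where
  /-- `Q` is a conjugacy class of involutions. -/
  conj_class : ∃ i ∈ involutions G, Q = conjugatesOf i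
  line_subset : ∀ l ∈ Λ, l ⊆ Q
  line_nontrivial : ∀ l ∈ Λ, l.Nontrivial
  /-- `Λ` is `G`-invariant. -/
  invariant : ∀ l ∈ Λ, ∀ g : G, conjSet l g ∈ Λ
  line_eq : ∀ l ∈ Λ, ∀ i ∈ l, ∀ j ∈ l, i ≠ j → l = lineThrough Q i j
  /-- Midpoints exist and are unique. -/
  midpoint : ∀ i ∈ Q, ∀ j ∈ Q, ∃! k, k ∈ Q ∧ k⁻¹ * i * k = j
  /-- At most one point reflects one line to a different one. -/
  reflect : ∀ l ∈ Λ, ∀ i ∈ Q, ∀ j ∈ Q, i ≠ j → conjSet l i = conjSet l j →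
    conjSet l i = l ∧ conjSet l j = l

/-- `(Q, Λ)` is a mock hyperbolic reflection space in `G`: all lines exist. -/
structure IsMockHyperbolic {G : Type*} [Group G] (Q : Set G) (Λ : Set (Set G)) : Prop
    extends IsPartialMockHyperbolic Q Λ where
  line_exists : ∀ i ∈ Q, ∀ j ∈ Q, i ≠ j → lineThrough Q i j ∈ Λ

/-- `Q` forms a mock hyperbolic reflection space, with lines all the `ℓ_{ij}`. -/
def FormsMockHyperbolic {G : Type*} [Group G] (Q : Set G) : Prop :=
  IsMockHyperbolic Q {l | ∃ i ∈ Q, ∃ j ∈ Q, i ≠ j ∧ l = lineThrough Q i j}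

/-! ### Sharply 2-transitive groups -/

/-- `G` acts regularly on ordered pairs of distinct points of `X`, and `X` has at least two
points. Such an action is automatically faithful. -/
structure IsSharplyTwoTransitive (G X : Type*) [Group G] [MulAction G X] : Prop where
  nontrivial : Nontrivial X
  sharp : ∀ x y x' y' : X, x ≠ y → x' ≠ y' → ∃! g : G, g • x = x' ∧ g • y = y'

/-- No involution of `G` has a fixed point in `X`. -/
def InvolutionsFixNoPoint (G X : Type*) [Group G] [MulAction G X] : Prop :=
  ∀ g ∈ involutions G, ∀ x : X, g • x ≠ x

/-- The sharply 2-transitive group `G` on `X` has permutation characteristic `p`: `p = 2` if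
involutions have no fixed point, and otherwise `p` is the order of the nontrivial translations
(products of two involutions), where `p = 0` stands for infinite order. -/
def HasPermChar (G X : Type*) [Group G] [MulAction G X] (p : ℕ) : Prop :=
  (InvolutionsFixNoPoint G X ∧ p = 2) ∨
  (¬ InvolutionsFixNoPoint G X ∧
    ∀ i ∈ involutions G, ∀ j ∈ involutions G, i * j ≠ 1 → orderOf (i * j) = p)

/-- Descending chain condition for centralizers of subsets. -/
def CentralizerDCC (G : Type*) [Group G] : Prop :=
  ∀ A : ℕ → Set G,
    (∀ n, Subgroup.centralizer (A (n + 1)) ≤ Subgroup.centralizer (A n)) →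
    ∃ N, ∀ n, N ≤ n → Subgroup.centralizer (A n) = Subgroup.centralizer (A N)

/-! ### Near-fields -/

/-- Near-fields, with the left distributive law. (Commutativity of the addition is a
consequence of these axioms.) -/
class NearField (K : Type*) extends AddGroup K, GroupWithZero K where
  left_distrib' : ∀ a b c : K, a * (b + c) = a * b + a * c

/-- A near-field is planar if `a x = b x + c` has a unique solution whenever `a ≠ b`. -/
def NearField.IsPlanar (K : Type*) [NearField K] : Prop :=
  ∀ a b c : K, a ≠ b → ∃! x : K, a * x = b * x + c

theorem NearField.mul_neg' {K : Type*} [NearField K] (a b : K) : a * -b = -(a * b) := by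
  have h := NearField.left_distrib' a b (-b)
  rw [add_neg_cancel, mul_zero] at h
  exact eq_neg_of_add_eq_zero_right h.symm

/-- The group of affine permutations `z ↦ b + a z`, `a ≠ 0`, of a near-field, that is
`K ⋊ Kˣ` acting on `K`. -/
def NearField.affineGroup (K : Type*) [NearField K] : Subgroup (Equiv.Perm K) where
  carrier := {f | ∃ a b : K, a ≠ 0 ∧ ∀ z, f z = b + a * z}
  one_mem' := ⟨1, 0, one_ne_zero, fun z => by simp⟩
  mul_mem' := by
    rintro f g ⟨a, b, ha, hf⟩ ⟨c, d, hc, hg⟩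
    refine ⟨a * c, b + a * d, mul_ne_zero ha hc, fun z => ?_⟩
    rw [Equiv.Perm.mul_apply, hg, hf, NearField.left_distrib', mul_assoc, add_assoc]
  inv_mem' := by
    rintro f ⟨a, b, ha, hf⟩
    refine ⟨a⁻¹, -(a⁻¹ * b), inv_ne_zero ha, fun z => ?_⟩
    rw [Equiv.Perm.inv_eq_iff_eq, hf, NearField.left_distrib', NearField.mul_neg',
      mul_inv_cancel_left₀ ha, mul_inv_cancel_left₀ ha, add_neg_cancel_left]

/-- The permutation group given by `ρ : H →* Perm X` is isomorphic, as a permutation group, to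
the affine group of `K`: it is the split sharply 2-transitive group corresponding to `K`. -/
def CorrespondsToNearField {H X : Type*} [Group H] (ρ : H →* Equiv.Perm X)
    (K : Type*) [NearField K] : Prop :=
  ∃ (φ : H ≃* NearField.affineGroup K) (e : X ≃ K),
    ∀ (h : H) (x : X), e (ρ h x) = (φ h : Equiv.Perm K) (e x)

/-- The action by conjugation of `N_G(S)` on a subset `S` of `G`. -/
def normalizerConj {G : Type*} [Group G] (S : Set G) :
    Subgroup.normalizer S →* Equiv.Perm S where
  toFun g :=
    { toFun := fun s => ⟨g * s * (g : G)⁻¹, (g.2 s).1 s.2⟩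
      invFun := fun s => ⟨(g : G)⁻¹ * s * g, by
        have h := (g⁻¹.2 (s : G)).1 s.2
        simpa using h⟩
      left_inv := fun s => Subtype.ext (by simp [mul_assoc])
      right_inv := fun s => Subtype.ext (by simp [mul_assoc]) }
  map_one' := by ext s; simp
  map_mul' g h := by ext s; simp [mul_assoc]

/-- `K` is the maximal near-field of the sharply 2-transitive group `G`: for a line `ℓ_{ij}` of
involutions, `N_G(ℓ_{ij})` acting on `ℓ_{ij}` is the split sharply 2-transitive group
corresponding to `K`. All lines being conjugate, `K` does not depend on the line, up to
isomorphism. -/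
def IsMaximalNearField (G : Type*) [Group G] (K : Type*) [NearField K] : Prop :=
  ∃ i ∈ involutions G, ∃ j ∈ involutions G, i ≠ j ∧
    CorrespondsToNearField (normalizerConj (lineThrough (involutions G) i j)) K

/-- The maximal near-field of `G` is planar. The existence of the near-field is not part of this
condition. -/
def MaximalNearFieldIsPlanar (G : Type u) [Group G] : Prop :=
  ∀ (K : Type u) [NearField K], IsMaximalNearField G K → NearField.IsPlanar K

/-! ### Groups of finite Morley rank -/

/-- `MR(s) ≥ n`, computed in the structure `M`, for natural numbers `n`: `MR(s) ≥ 0` if `s` is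
nonempty, and `MR(s) ≥ n + 1` if `s` contains infinitely many pairwise disjoint definable (with
parameters) subsets of rank at least `n`. -/
def MorleyRankGE (L : FirstOrder.Language) (M : Type*) [L.Structure M] : ℕ → Set M → Prop
  | 0, s => s.Nonempty
  | n + 1, s => ∃ t : ℕ → Set M, Pairwise (fun k l => Disjoint (t k) (t l)) ∧
      ∀ k, t k ⊆ s ∧ (Set.univ : Set M).Definable₁ L (t k) ∧ MorleyRankGE L M n (t k)

/-- `ℵ₀`-saturation: for finite `A`, a family of `A`-definable sets with the finite intersection
property has a common point. -/
def IsOmegaSaturated (L : FirstOrder.Language) (M : Type*) [L.Structure M] : Prop :=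
  ∀ A : Set M, A.Finite → ∀ F : Set (Set M), (∀ s ∈ F, A.Definable₁ L s) →
    (∀ E : Set (Set M), E.Finite → E ⊆ F → (⋂₀ E).Nonempty) → (⋂₀ F).Nonempty

/-- `M` has finite Morley rank. The Morley rank is computed in an `ℵ₀`-saturated elementary
extension (and does not depend on its choice). -/
def HasFiniteMorleyRank (L : FirstOrder.Language.{v, w}) (M : Type u)
    [L.Structure M] : Prop :=
  ∃ (N : Type (max u v w)) (_ : L.Structure N) (_ : L.ElementaryEmbedding M N),
    IsOmegaSaturated L N ∧ ∃ n : ℕ, ¬ MorleyRankGE L N n Set.univ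

/-- `G` with the structure `L` is a group of finite Morley rank: the multiplication is definable
and the structure, which may be richer than the pure group, has finite Morley rank. -/
structure IsGroupOfFiniteMorleyRank (L : FirstOrder.Language.{v, w}) (G : Type u)
    [Group G] [L.Structure G] : Prop where
  mul_definable : (Set.univ : Set G).Definable L {v : Fin 3 → G | v 0 * v 1 = v 2}
  finite_rank : HasFiniteMorleyRank L G

/-!
Suppose that some involution fixes a point. Then every point is fixed by exactly one involution, so
`G` acts on the set `J` of involutions by conjugation as it acts on `X`, sharply 2-transitively
(`IsSharplyTwoTransitive.sharpOnInvolutions`). From here on `X` plays no role, except when `G` is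
split. The involutions exchanging `i` and `j` by conjugation give the unique midpoints. A product
`ij` with `i ≠ j` is called a translation.

If `k` is the midpoint of `i` and `j`, then `(ik)² = ij`. The proof rests on the condition
`CentralizersContainRoots`: whatever centralizes `ij` centralizes `ik`. In characteristic `p > 2` it
holds as `ik` is a power of `ij`. Otherwise, as all configurations `(i, j, k)` are conjugate, its
failure produces an infinite strictly descending chain of centralizers of elements
(`SharpOnInvolutions.exists_strictAnti_centralizer`), against the descending chain condition.

Given the condition, `i` inverts the centralizer `A` of `ij` (`SharpOnInvolutions.conj_eq_inv`). So
`A` is abelian, it is the centralizer of each of its nontrivial elements, and the line through `i` and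
`j` is `iA`. This makes any two points of a line determine it, and the normalizer of a line is
`A ⋊ H`, where `H` stabilizes `i` and is regular on `A \ {1}`. If two points `p` and `q` reflect a line
to the same line, then `pq` normalizes the line and fixes no point of it. If every such element is in
`A`, then `p` and `q` invert a nontrivial element of `A`, so they lie on the line and preserve it, as
the reflection axiom demands. The elements without fixed points are in `A` if `x ↦ x - hx` maps `A`
onto `A` for all `h ≠ 1` in `H` (`SharpOnInvolutions.CommutatorsSurjective`). This follows from
planarity of the near-field with additive group `A` and multiplicative group `H`, which is
constructed in `SharpOnInvolutions.lineNearField` and is a maximal near-field of `G`.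

If `G` has finite Morley rank, there is no infinite strictly descending chain of definable subgroups,
because the cosets of its members would have arbitrarily large rank. Applied to centralizers, this
gives the condition on roots. Applied to the images of the powers of the injective endomorphism
`x ↦ x - hx` of `A`, it gives surjectivity.

If `G` is split over a planar near-field, the products of two involutions form the translation group,
so all involutions lie on a single line (`IsSharplyTwoTransitive.lineThrough_eq_of_isPlanar`).
-/

/-! ### The action on involutions -/

section InvolutionActions

variable {G : Type*} [Group G]

theorem inv_eq_self_of_mem_involutions {i : G} (hi : i ∈ involutions G) : i⁻¹ = i :=
  inv_eq_of_mul_eq_one_left hi.2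

theorem mul_mul_self_of_mem_involutions {i : G} (hi : i ∈ involutions G) (x : G) :
    i * (i * x) = x := by
  rw [← mul_assoc, hi.2, one_mul]

theorem conj_mem_involutions {i : G} (hi : i ∈ involutions G) (g : G) :
    g * i * g⁻¹ ∈ involutions G := by
  refine ⟨fun h => hi.1 ?_, ?_⟩
  · simpa [mul_assoc] using congrArg (fun x => g⁻¹ * x * g) h
  · simp [mul_assoc, mul_mul_self_of_mem_involutions hi]

theorem conj_involution_mem_involutions {i k : G} (hi : i ∈ involutions G)
    (hk : k ∈ involutions G) : k * i * k ∈ involutions G := by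
  have h := conj_mem_involutions hi k
  rwa [inv_eq_self_of_mem_involutions hk] at h

theorem conj_conj {i : G} (hi : i ∈ involutions G) (x : G) : i * (i * x * i) * i = x := by
  simp only [mul_assoc, mul_mul_self_of_mem_involutions hi, hi.2, mul_one]

theorem semiconjBy_of_conj_eq {i x y : G} (hi : i ∈ involutions G) (h : i * x * i = y) :
    SemiconjBy i x y := by
  rw [SemiconjBy, ← h, mul_assoc _ i i, hi.2, mul_one]

/-- Conjugation by `G` on its involutions is a sharply 2-transitive action. -/
structure SharpOnInvolutions (G : Type*) [Group G] : Prop where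
  nonempty : (involutions G).Nonempty
  trans : ∀ i ∈ involutions G, ∀ j ∈ involutions G, i ≠ j → ∀ i' ∈ involutions G,
    ∀ j' ∈ involutions G, i' ≠ j' → ∃ g : G, g * i * g⁻¹ = i' ∧ g * j * g⁻¹ = j'
  free : ∀ i ∈ involutions G, ∀ j ∈ involutions G, i ≠ j → ∀ g : G,
    g * i = i * g → g * j = j * g → g = 1

namespace IsSharplyTwoTransitive

variable {X : Type*} [MulAction G X] {i j : G}

theorem eq_of_smul_eq (hG : IsSharplyTwoTransitive G X) {x y : X} {g h : G} (hxy : x ≠ y)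
    (hx : g • x = h • x) (hy : g • y = h • y) : g = h := by
  have hne : h • x ≠ h • y := fun e => hxy (MulAction.injective h e)
  exact (hG.sharp x y (h • x) (h • y) hxy hne).unique ⟨hx, hy⟩ ⟨rfl, rfl⟩

/-- Involutions swapping the same pair coincide. -/
theorem eq_of_smul_eq_of_ne (hG : IsSharplyTwoTransitive G X) (hi : i ∈ involutions G)
    (hj : j ∈ involutions G) {x y : X} (hxy : x ≠ y) (h1 : i • x = y) (h2 : j • x = y) :
    i = j := by
  refine hG.eq_of_smul_eq hxy (h1.trans h2.symm) ?_
  nth_rewrite 1 [← h1]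
  rw [← h2, ← mul_smul, ← mul_smul, hi.2, hj.2]

theorem exists_smul_ne (hG : IsSharplyTwoTransitive G X) (hi : i ∈ involutions G) :
    ∃ y : X, i • y ≠ y := by
  obtain ⟨x₀, x₁, h01⟩ := hG.nontrivial
  by_contra! h
  exact hi.1 (hG.eq_of_smul_eq h01 (by simp [h]) (by simp [h]))

theorem conj_eq_of_smul (hG : IsSharplyTwoTransitive G X) (hi : i ∈ involutions G)
    (hj : j ∈ involutions G) (g : G) {y : X} (hy : i • y ≠ y) (h : g • i • y = j • g • y) :
    g * i * g⁻¹ = j := by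
  refine hG.eq_of_smul_eq_of_ne (x := g • y) (y := g • i • y) (conj_mem_involutions hi g) hj ?_ ?_
    h.symm
  · exact fun e => hy (MulAction.injective g e.symm)
  · simp [mul_smul]

theorem exists_conj_eq (hG : IsSharplyTwoTransitive G X) (hi : i ∈ involutions G)
    (hj : j ∈ involutions G) : ∃ g : G, g * i * g⁻¹ = j := by
  obtain ⟨y, hy⟩ := hG.exists_smul_ne hi
  obtain ⟨z, hz⟩ := hG.exists_smul_ne hj
  obtain ⟨g, ⟨h1, h2⟩, -⟩ := hG.sharp y (i • y) z (j • z) hy.symm hz.symm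
  exact ⟨g, hG.conj_eq_of_smul hi hj g hy (by rw [h1, h2])⟩

theorem fixedPoint_unique (hG : IsSharplyTwoTransitive G X) (hi : i ∈ involutions G) {x y : X}
    (hx : i • x = x) (hy : i • y = y) : x = y := by
  by_contra h
  exact hi.1 (hG.eq_of_smul_eq h (by simp [hx]) (by simp [hy]))

/-- A point is fixed by at most one involution. If `i` and `j` both fix `x`, then for `y ≠ x` some
element `g` fixing `y` takes `i • y` to `j • y`. It conjugates `i` to `j`, hence fixes `x`, and is
trivial. -/
theorem eq_of_smul_eq_self (hG : IsSharplyTwoTransitive G X) (hi : i ∈ involutions G)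
    (hj : j ∈ involutions G) {x : X} (h1 : i • x = x) (h2 : j • x = x) : i = j := by
  obtain ⟨y, hy⟩ := hG.exists_smul_ne hi
  have hxy : x ≠ y := by rintro rfl; exact hy h1
  have hjy : j • y ≠ y := fun e => hxy (hG.fixedPoint_unique hj h2 e)
  obtain ⟨g, ⟨g1, g2⟩, -⟩ := hG.sharp y (i • y) y (j • y) hy.symm hjy.symm
  have hg : g * i * g⁻¹ = j := hG.conj_eq_of_smul hi hj g hy (by rw [g1, g2])
  have hgx : g • x = x := by
    refine hG.fixedPoint_unique hj ?_ h2
    rw [← hg]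
    simp [mul_smul, h1]
  have : g = 1 := hG.eq_of_smul_eq hxy (by simp [hgx]) (by simp [g1])
  rw [← hg, this]
  simp

theorem mul_smul_ne (hG : IsSharplyTwoTransitive G X) (hi : i ∈ involutions G)
    (hj : j ∈ involutions G) (hij : i ≠ j) (x : X) : (i * j) • x ≠ x := by
  intro h
  have h' : j • x = i • x := by
    rw [mul_smul] at h
    nth_rewrite 2 [← h]
    rw [← mul_smul, hi.2, one_smul]
  by_cases hx : i • x = x
  · exact hij (hG.eq_of_smul_eq_self hi hj hx (h'.trans hx))
  · exact hij (hG.eq_of_smul_eq_of_ne hi hj (Ne.symm hx) rfl h')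

theorem exists_fixedPoint (hG : IsSharplyTwoTransitive G X) (hfix : ¬ InvolutionsFixNoPoint G X)
    (hi : i ∈ involutions G) : ∃ x : X, i • x = x := by
  simp only [InvolutionsFixNoPoint] at hfix
  push Not at hfix
  obtain ⟨i₀, hi₀, x, hx⟩ := hfix
  obtain ⟨g, rfl⟩ := hG.exists_conj_eq hi₀ hi
  exact ⟨g • x, by simp [mul_smul, hx]⟩

theorem smul_eq_self_of_commute (hG : IsSharplyTwoTransitive G X) (hi : i ∈ involutions G) {x : X}
    (hx : i • x = x) {g : G} (h : g * i = i * g) : g • x = x := by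
  refine hG.fixedPoint_unique hi ?_ hx
  rw [← mul_smul, ← h, mul_smul, hx]

/-- If some involution fixes a point, then sending an involution to its fixed point identifies the
action by conjugation on the involutions with the given sharply 2-transitive action. -/
theorem sharpOnInvolutions (hG : IsSharplyTwoTransitive G X)
    (hfix : ¬ InvolutionsFixNoPoint G X) : SharpOnInvolutions G := by
  refine ⟨?_, ?_, ?_⟩
  · simp only [InvolutionsFixNoPoint] at hfix
    push Not at hfix
    obtain ⟨i, hi, -⟩ := hfix
    exact ⟨i, hi⟩
  · intro i hi j hj hij i' hi' j' hj' hij'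
    obtain ⟨x, hx⟩ := hG.exists_fixedPoint hfix hi
    obtain ⟨y, hy⟩ := hG.exists_fixedPoint hfix hj
    obtain ⟨x', hx'⟩ := hG.exists_fixedPoint hfix hi'
    obtain ⟨y', hy'⟩ := hG.exists_fixedPoint hfix hj'
    have hxy : x ≠ y := by rintro rfl; exact hij (hG.eq_of_smul_eq_self hi hj hx hy)
    have hxy' : x' ≠ y' := by rintro rfl; exact hij' (hG.eq_of_smul_eq_self hi' hj' hx' hy')
    obtain ⟨g, ⟨g1, g2⟩, -⟩ := hG.sharp x y x' y' hxy hxy'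
    refine ⟨g, hG.eq_of_smul_eq_self (conj_mem_involutions hi g) hi' (x := x') ?_ hx',
      hG.eq_of_smul_eq_self (conj_mem_involutions hj g) hj' (x := y') ?_ hy'⟩
    · rw [← g1]; simp [mul_smul, hx]
    · rw [← g2]; simp [mul_smul, hy]
  · intro i hi j hj hij g h1 h2
    obtain ⟨x, hx⟩ := hG.exists_fixedPoint hfix hi
    obtain ⟨y, hy⟩ := hG.exists_fixedPoint hfix hj
    have hxy : x ≠ y := by rintro rfl; exact hij (hG.eq_of_smul_eq_self hi hj hx hy)
    exact hG.eq_of_smul_eq hxy (by simp [hG.smul_eq_self_of_commute hi hx h1])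
      (by simp [hG.smul_eq_self_of_commute hj hy h2])

end IsSharplyTwoTransitive

namespace SharpOnInvolutions


theorem eq_of_commute (hS : SharpOnInvolutions G) {i j : G} (hi : i ∈ involutions G)
    (hj : j ∈ involutions G) (h : Commute i j) : i = j := by
  by_contra hij
  exact hi.1 (hS.free i hi j hj hij i rfl h.eq)

theorem eq_of_swap (hS : SharpOnInvolutions G) {i j m n : G} (hi : i ∈ involutions G)
    (hj : j ∈ involutions G) (hm : m ∈ involutions G) (hn : n ∈ involutions G) (hmn : m ≠ n)
    (h1 : i * m * i = n) (h2 : j * m * j = n) : i = j := by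
  have i1 : SemiconjBy i m n := semiconjBy_of_conj_eq hi h1
  have i2 : SemiconjBy i n m := semiconjBy_of_conj_eq hi (by rw [← h1]; exact conj_conj hi m)
  have j1 : SemiconjBy j m n := semiconjBy_of_conj_eq hj h2
  have j2 : SemiconjBy j n m := semiconjBy_of_conj_eq hj (by rw [← h2]; exact conj_conj hj m)
  have : i * j = 1 := hS.free m hm n hn hmn (i * j) (i2.mul_left j1) (i1.mul_left j2)
  rw [mul_eq_one_iff_eq_inv, inv_eq_self_of_mem_involutions hj] at this
  exact this

theorem exists_swap (hS : SharpOnInvolutions G) {i j : G} (hi : i ∈ involutions G)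
    (hj : j ∈ involutions G) (hij : i ≠ j) : ∃ k ∈ involutions G, k * i * k = j := by
  obtain ⟨k, h1, h2⟩ := hS.trans i hi j hj hij j hj i hi hij.symm
  have h1' : SemiconjBy k i j := by rw [SemiconjBy, ← h1]; simp
  have h2' : SemiconjBy k j i := by rw [SemiconjBy, ← h2]; simp
  have hkk : k * k = 1 := hS.free i hi j hj hij _ (h2'.mul_left h1') (h1'.mul_left h2')
  refine ⟨k, ⟨?_, hkk⟩, ?_⟩
  · rintro rfl
    exact hij (by simpa using h1)
  · rw [← h1, inv_eq_of_mul_eq_one_left hkk]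

/-- A product of two distinct involutions acts on the involutions without fixed points. -/
theorem not_commute_mul (hS : SharpOnInvolutions G) {i j m : G} (hi : i ∈ involutions G)
    (hj : j ∈ involutions G) (hij : i ≠ j) (hm : m ∈ involutions G) :
    ¬ Commute (i * j) m := by
  intro h
  by_cases hn : Commute i m
  · have h1 := hS.eq_of_commute hi hm hn
    have h2 : Commute j m := by
      have := (Commute.inv_left hn).mul_left h
      rwa [inv_mul_cancel_left] at this
    exact hij (h1.trans (hS.eq_of_commute hj hm h2).symm)
  · refine hij (hS.eq_of_swap hi hj hm (conj_involution_mem_involutions hm hi) ?_ rfl ?_)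
    · intro e
      refine hn (SemiconjBy.eq ?_)
      exact semiconjBy_of_conj_eq hi e.symm
    · have hii := hi.2
      have hjj := hj.2
      have h' : i * j * m = m * (i * j) := h
      calc j * m * j = i * (i * j * m) * j := by simp only [← mul_assoc, hii, one_mul]
        _ = i * m * i * (j * j) := by rw [h']; simp only [mul_assoc]
        _ = i * m * i := by rw [hjj, mul_one]

/-- The centralizer of a product of two distinct involutions acts freely on the involutions. -/
theorem eq_one_of_commute_mul (hS : SharpOnInvolutions G) {i j m c : G} (hi : i ∈ involutions G)
    (hj : j ∈ involutions G) (hij : i ≠ j) (hm : m ∈ involutions G)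
    (hc : Commute c (i * j)) (hcm : Commute c m) : c = 1 := by
  refine hS.free m hm _ (conj_mem_involutions hm (i * j)) ?_ c hcm ?_
  · intro h
    refine hS.not_commute_mul hi hj hij hm (SemiconjBy.eq ?_)
    rw [SemiconjBy]
    nth_rewrite 2 [h]
    simp [mul_assoc]
  · exact ((hc.mul_right hcm).mul_right hc.inv_right).eq

end SharpOnInvolutions
end InvolutionActions

/-! ### Centralizers of translations and lines -/

section CentralizersOfTranslations

variable {G : Type*} [Group G]

theorem semiconjBy_inv_mul {k q : G} (hk : k ∈ involutions G) (hq : q ∈ involutions G) :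
    SemiconjBy k (k * q) (k * q)⁻¹ := by
  rw [SemiconjBy, mul_inv_rev, inv_eq_self_of_mem_involutions hk,
    inv_eq_self_of_mem_involutions hq, mul_mul_self_of_mem_involutions hk, mul_assoc, hk.2, mul_one]

theorem SemiconjBy.inv_swap {k x : G} (h : SemiconjBy k x x⁻¹) : SemiconjBy k x⁻¹ x := by
  simpa using h.inv_right

/-- For the midpoint `k` of `i` and `j`, the translation `ik` is a square root of `ij`. The condition
says that it is centralized by everything that centralizes `ij`. -/
def CentralizersContainRoots (G : Type*) [Group G] : Prop :=
  ∀ i ∈ involutions G, ∀ j ∈ involutions G, i ≠ j → ∀ k ∈ involutions G, k * i * k = j →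
    ∀ c : G, Commute c (i * j) → Commute c (i * k)

theorem conj_mem_lineThrough {i j : G} (g m : G)
    (hm : m ∈ lineThrough (involutions G) i j) :
    g * m * g⁻¹ ∈ lineThrough (involutions G) (g * i * g⁻¹) (g * j * g⁻¹) := by
  obtain ⟨hm, q, hq, h⟩ := hm
  refine ⟨conj_mem_involutions hm g, _, conj_mem_involutions hq g, ?_⟩
  rw [conj_mul, conj_mul, h]

theorem conj_mem_lineThrough_iff {i j : G} (g m : G) :
    g * m * g⁻¹ ∈ lineThrough (involutions G) (g * i * g⁻¹) (g * j * g⁻¹) ↔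
      m ∈ lineThrough (involutions G) i j := by
  refine ⟨fun h => ?_, conj_mem_lineThrough g m⟩
  simpa [mul_assoc] using conj_mem_lineThrough g⁻¹ _ h

theorem left_mem_lineThrough {i j : G} (hi : i ∈ involutions G) (hj : j ∈ involutions G) :
    i ∈ lineThrough (involutions G) i j := ⟨hi, j, hj, rfl⟩

theorem right_mem_lineThrough {i j : G} (hi : i ∈ involutions G) (hj : j ∈ involutions G) :
    j ∈ lineThrough (involutions G) i j :=
  ⟨hj, _, conj_involution_mem_involutions hi hj,
    by rw [mul_assoc, mul_mul_self_of_mem_involutions hj]⟩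

namespace SharpOnInvolutions

variable {i j : G}

/-- A line consists of the involutions that invert the translation `ij`, as `i` does. -/
theorem mem_lineThrough_iff (hS : SharpOnInvolutions G) (hi : i ∈ involutions G)
    (hj : j ∈ involutions G) (hij : i ≠ j) {k : G} :
    k ∈ lineThrough (involutions G) i j ↔ k ∈ involutions G ∧ Commute (i * k) (i * j) := by
  have hinv := semiconjBy_inv_mul hi hj
  constructor
  · rintro ⟨hk, q, hq, h⟩
    have hk' := semiconjBy_inv_mul hk hq
    rw [← h] at hk'
    exact ⟨hk, hinv.inv_swap.mul_left hk'⟩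
  · rintro ⟨hk, h⟩
    refine ⟨hk, k * (i * j), ⟨?_, ?_⟩, (mul_mul_self_of_mem_involutions hk _).symm⟩
    · intro e
      refine hS.not_commute_mul hi hj hij hk ?_
      rw [← inv_eq_of_mul_eq_one_right e]
      exact (Commute.refl k).inv_left
    · have h' : SemiconjBy k (i * j) (i * j)⁻¹ := by
        have := hinv.mul_left h
        rwa [mul_mul_self_of_mem_involutions hi] at this
      have e : k * (i * j) = (i * j)⁻¹ * k := h'
      rw [mul_assoc, ← mul_assoc (i * j) k, ← mul_assoc k, ← mul_assoc k, e, mul_assoc _ k k,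
        hk.2, mul_one, inv_mul_cancel]

/-- If `k` is the midpoint of `i` and `c⁻¹ic`, then `ck` commutes with `i`, and `cki` commutes both
with `i` and with `ij`. This forces `c = ik`. -/
theorem conj_eq_inv (hS : SharpOnInvolutions G) (hR : CentralizersContainRoots G)
    (hi : i ∈ involutions G) (hj : j ∈ involutions G) (hij : i ≠ j) {c : G}
    (hc : Commute c (i * j)) : SemiconjBy i c c⁻¹ := by
  by_cases hci : Commute c i
  · rw [hS.eq_one_of_commute_mul hi hj hij hi hc hci]
    simp
  have hi' : c⁻¹ * i * c ∈ involutions G := by simpa using conj_mem_involutions hi c⁻¹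
  have hne : i ≠ c⁻¹ * i * c := by
    intro h
    refine hci (SemiconjBy.eq ?_)
    rw [SemiconjBy]
    nth_rewrite 1 [h]
    simp [mul_assoc]
  obtain ⟨k, hk, hki⟩ := hS.exists_swap hi hi' hne
  have hinv := semiconjBy_inv_mul hi hj
  have hστ : Commute (i * j) (i * (c⁻¹ * i * c)) := by
    have h1 : SemiconjBy (c⁻¹ * i * c) (i * j) (i * j)⁻¹ :=
      (SemiconjBy.mul_left hc.inv_left.inv_right hinv).mul_left hc
    exact (hinv.inv_swap.mul_left h1 : Commute _ _).symm
  have hik : Commute (i * j) (i * k) := hR i hi _ hi' hne k hk hki _ hστ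
  have h1 : SemiconjBy k i (c⁻¹ * i * c) := semiconjBy_of_conj_eq hk hki
  have h2 : SemiconjBy c (c⁻¹ * i * c) i := by rw [SemiconjBy]; simp [mul_assoc]
  have h3 : Commute (c * k) i := h2.mul_left h1
  have h4 : Commute (c * (k * i)) (i * j) := by
    have : k * i = (i * k)⁻¹ := by
      rw [mul_inv_rev, inv_eq_self_of_mem_involutions hi, inv_eq_self_of_mem_involutions hk]
    rw [this]
    exact hc.mul_left hik.symm.inv_left
  have h5 : Commute (c * (k * i)) i := by
    rw [← mul_assoc]
    exact h3.mul_left (Commute.refl i)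
  have h6 : c = i * k := by
    rw [mul_eq_one_iff_eq_inv.1 (hS.eq_one_of_commute_mul hi hj hij hi h4 h5), mul_inv_rev,
      inv_eq_self_of_mem_involutions hi, inv_eq_self_of_mem_involutions hk]
  rw [h6]
  exact semiconjBy_inv_mul hi hk

theorem conj_eq_inv' (hS : SharpOnInvolutions G) (hR : CentralizersContainRoots G)
    (hi : i ∈ involutions G) (hj : j ∈ involutions G) (hij : i ≠ j) {c : G}
    (hc : Commute c (i * j)) : i * c * i = c⁻¹ := by
  rw [(hS.conj_eq_inv hR hi hj hij hc).eq, mul_assoc, hi.2, mul_one]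

/-- The centralizer of a translation is abelian, as an involution inverts it. -/
theorem commute_of_commute (hS : SharpOnInvolutions G) (hR : CentralizersContainRoots G)
    (hi : i ∈ involutions G) (hj : j ∈ involutions G) (hij : i ≠ j) {c d : G}
    (hc : Commute c (i * j)) (hd : Commute d (i * j)) : Commute c d := by
  have h1 := (hS.conj_eq_inv hR hi hj hij hc).mul_right (hS.conj_eq_inv hR hi hj hij hd)
  have h2 := hS.conj_eq_inv hR hi hj hij (hc.mul_left hd)
  have h3 : c⁻¹ * d⁻¹ = (c * d)⁻¹ := mul_right_cancel (h1.eq.symm.trans h2.eq)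
  rw [mul_inv_rev] at h3
  have h4 : Commute c⁻¹ d⁻¹ := h3
  simpa using h4.inv_left.inv_right

theorem mul_mem_involutions (hS : SharpOnInvolutions G) (hR : CentralizersContainRoots G)
    (hi : i ∈ involutions G) (hj : j ∈ involutions G) (hij : i ≠ j) {c : G}
    (hc : Commute c (i * j)) : i * c ∈ involutions G := by
  refine ⟨fun h => ?_, ?_⟩
  · refine hS.not_commute_mul hi hj hij hi ?_
    have : c = i := by rw [← inv_eq_of_mul_eq_one_right h, inv_eq_self_of_mem_involutions hi]
    exact (this ▸ hc).symm
  · rw [← mul_assoc, hS.conj_eq_inv' hR hi hj hij hc, inv_mul_cancel]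

/-- Nontrivial elements of the centralizer of a translation have the same centralizer. -/
theorem commute_of_commute_of_ne_one (hS : SharpOnInvolutions G) (hR : CentralizersContainRoots G)
    (hi : i ∈ involutions G) (hj : j ∈ involutions G) (hij : i ≠ j) {c d : G}
    (hc : Commute c (i * j)) (hc1 : c ≠ 1) (hd : Commute d c) : Commute d (i * j) := by
  have e : i * (i * c) = c := mul_mul_self_of_mem_involutions hi c
  exact hS.commute_of_commute hR hi (hS.mul_mem_involutions hR hi hj hij hc)
    (fun h => hc1 (by simpa using h)) (by rwa [e]) (by rw [e]; exact hc.symm)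

theorem commute_mul_of_mem_lineThrough (hS : SharpOnInvolutions G)
    (hi : i ∈ involutions G) (hj : j ∈ involutions G) (hij : i ≠ j) {k l : G}
    (hk : k ∈ lineThrough (involutions G) i j) (hl : l ∈ lineThrough (involutions G) i j) :
    Commute (k * l) (i * j) := by
  rw [hS.mem_lineThrough_iff hi hj hij] at hk hl
  have : k * l = (i * k)⁻¹ * (i * l) := by
    rw [mul_inv_rev, inv_eq_self_of_mem_involutions hi, inv_eq_self_of_mem_involutions hk.1,
      mul_assoc, mul_mul_self_of_mem_involutions hi]
  rw [this]
  exact hk.2.inv_left.mul_left hl.2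

theorem lineThrough_eq (hS : SharpOnInvolutions G) (hR : CentralizersContainRoots G)
    (hi : i ∈ involutions G) (hj : j ∈ involutions G) (hij : i ≠ j) {k l : G}
    (hk : k ∈ lineThrough (involutions G) i j) (hl : l ∈ lineThrough (involutions G) i j)
    (hkl : k ≠ l) :
    lineThrough (involutions G) i j = lineThrough (involutions G) k l := by
  have hklσ := hS.commute_mul_of_mem_lineThrough hi hj hij hk hl
  have hkl1 : k * l ≠ 1 := by
    intro h
    rw [mul_eq_one_iff_eq_inv, inv_eq_self_of_mem_involutions hl.1] at h
    exact hkl h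
  ext m
  rw [hS.mem_lineThrough_iff hk.1 hl.1 hkl]
  constructor
  · intro hm
    exact ⟨hm.1, hS.commute_of_commute hR hi hj hij
      (hS.commute_mul_of_mem_lineThrough hi hj hij hk hm) hklσ⟩
  · rintro ⟨hm, h⟩
    rw [hS.mem_lineThrough_iff hi hj hij] at hk ⊢
    refine ⟨hm, ?_⟩
    have : i * m = i * k * (k * m) := by
      rw [mul_assoc, mul_mul_self_of_mem_involutions hk.1]
    rw [this]
    exact hk.2.mul_left (hS.commute_of_commute_of_ne_one hR hi hj hij hklσ hkl1 h)

/-- An element taking two points of a line to the line normalizes the line. -/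
theorem mem_normalizer_of_conj_mem (hS : SharpOnInvolutions G) (hR : CentralizersContainRoots G)
    (hi : i ∈ involutions G) (hj : j ∈ involutions G) (hij : i ≠ j) {g k l : G}
    (hk : k ∈ lineThrough (involutions G) i j) (hl : l ∈ lineThrough (involutions G) i j)
    (hkl : k ≠ l) (hgk : g * k * g⁻¹ ∈ lineThrough (involutions G) i j)
    (hgl : g * l * g⁻¹ ∈ lineThrough (involutions G) i j) :
    g ∈ Subgroup.normalizer (lineThrough (involutions G) i j) := by
  have hne : g * k * g⁻¹ ≠ g * l * g⁻¹ := fun h => hkl (by simpa using h)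
  rw [Subgroup.mem_set_normalizer_iff]
  intro m
  nth_rewrite 2 [hS.lineThrough_eq hR hi hj hij hgk hgl hne]
  rw [conj_mem_lineThrough_iff, ← hS.lineThrough_eq hR hi hj hij hk hl hkl]

theorem mem_normalizer_of_commute (hS : SharpOnInvolutions G) (hR : CentralizersContainRoots G)
    (hi : i ∈ involutions G) (hj : j ∈ involutions G) (hij : i ≠ j) {t : G}
    (ht : Commute t (i * j)) : t ∈ Subgroup.normalizer (lineThrough (involutions G) i j) := by
  have key : ∀ m ∈ lineThrough (involutions G) i j,
      t * m * t⁻¹ ∈ lineThrough (involutions G) i j := by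
    intro m hm
    rw [hS.mem_lineThrough_iff hi hj hij] at hm ⊢
    refine ⟨conj_mem_involutions hm.1 t, ?_⟩
    have : i * (t * m * t⁻¹) = t⁻¹ * (i * m) * t⁻¹ := by
      rw [← hS.conj_eq_inv' hR hi hj hij ht]
      simp only [mul_assoc, mul_mul_self_of_mem_involutions hi]
    rw [this]
    exact (ht.inv_left.mul_left hm.2).mul_left ht.inv_left
  exact hS.mem_normalizer_of_conj_mem hR hi hj hij (left_mem_lineThrough hi hj)
    (right_mem_lineThrough hi hj) hij (key _ (left_mem_lineThrough hi hj))
    (key _ (right_mem_lineThrough hi hj))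

theorem commute_conj_of_mem_normalizer (hS : SharpOnInvolutions G)
    (hR : CentralizersContainRoots G) (hi : i ∈ involutions G) (hj : j ∈ involutions G)
    (hij : i ≠ j) {g c : G} (hg : g ∈ Subgroup.normalizer (lineThrough (involutions G) i j))
    (hc : Commute c (i * j)) : Commute (g * c * g⁻¹) (i * j) := by
  have e : i * (i * c) = c := mul_mul_self_of_mem_involutions hi c
  have h1 : i * c ∈ lineThrough (involutions G) i j := by
    rw [hS.mem_lineThrough_iff hi hj hij, e]
    exact ⟨hS.mul_mem_involutions hR hi hj hij hc, hc⟩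
  have := hS.commute_mul_of_mem_lineThrough hi hj hij
    ((hg i).1 (left_mem_lineThrough hi hj)) ((hg _).1 h1)
  rwa [conj_mul, e] at this

/-- The centralizer of `ij` is transitive on the line through `i` and `j`: square roots exist in it
as the midpoints do. -/
theorem exists_commute_conj_eq (hS : SharpOnInvolutions G) (hR : CentralizersContainRoots G)
    (hi : i ∈ involutions G) (hj : j ∈ involutions G) (hij : i ≠ j) {m : G}
    (hm : m ∈ lineThrough (involutions G) i j) :
    ∃ t, Commute t (i * j) ∧ t * i * t⁻¹ = m := by
  by_cases him : i = m
  · exact ⟨1, Commute.one_left _, by simp [him]⟩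
  obtain ⟨k, hk, hkm⟩ := hS.exists_swap hi hm.1 him
  have h := hR i hi m hm.1 him k hk hkm (i * j)
    ((hS.mem_lineThrough_iff hi hj hij).1 hm).2.symm
  refine ⟨(i * k)⁻¹, h.symm.inv_left, ?_⟩
  rw [inv_inv, mul_inv_rev, inv_eq_self_of_mem_involutions hi, inv_eq_self_of_mem_involutions hk,
    mul_assoc k i i, hi.2, mul_one, ← mul_assoc, hkm]

theorem eq_of_conj_eq (hS : SharpOnInvolutions G) (hi : i ∈ involutions G)
    (hj : j ∈ involutions G) (hij : i ≠ j) {s t : G} (hs : Commute s (i * j))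
    (ht : Commute t (i * j)) (h : s * i * s⁻¹ = t * i * t⁻¹) : s = t := by
  have : t⁻¹ * s = 1 := by
    refine hS.eq_one_of_commute_mul hi hj hij hi (ht.inv_left.mul_left hs) (SemiconjBy.eq ?_)
    have h' : s * i = t * i * t⁻¹ * s := by rw [← h]; simp
    rw [SemiconjBy, mul_assoc, h']
    simp [mul_assoc]
  exact (inv_mul_eq_one.1 this).symm

/-- The stabilizer of the point `i` in the normalizer of the line through `i` and `j`. -/
def pointStabilizer (i j : G) : Subgroup G :=
  Subgroup.normalizer (lineThrough (involutions G) i j) ⊓ Subgroup.centralizer {i}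

theorem mem_pointStabilizer {h : G} : h ∈ pointStabilizer i j ↔
    h ∈ Subgroup.normalizer (lineThrough (involutions G) i j) ∧ Commute h i := by
  rw [pointStabilizer, Subgroup.mem_inf, Subgroup.mem_centralizer_singleton_iff]
  rfl

/-- The normalizer of a line is the product of the centralizer of a translation along the line and
the stabilizer of a point. -/
theorem exists_mul_eq_of_mem_normalizer (hS : SharpOnInvolutions G)
    (hR : CentralizersContainRoots G) (hi : i ∈ involutions G) (hj : j ∈ involutions G)
    (hij : i ≠ j) {g : G} (hg : g ∈ Subgroup.normalizer (lineThrough (involutions G) i j)) :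
    ∃ t, Commute t (i * j) ∧ ∃ h ∈ pointStabilizer i j, g = t * h := by
  obtain ⟨t, ht, hti⟩ := hS.exists_commute_conj_eq hR hi hj hij
    ((hg i).1 (left_mem_lineThrough hi hj))
  refine ⟨t, ht, t⁻¹ * g, ?_, by simp⟩
  rw [mem_pointStabilizer]
  refine ⟨mul_mem (inv_mem (hS.mem_normalizer_of_commute hR hi hj hij ht)) hg, SemiconjBy.eq ?_⟩
  have h' : g * i = t * i * t⁻¹ * g := by rw [hti]; simp
  rw [SemiconjBy, mul_assoc, h']
  simp [mul_assoc]

/-- Sharp 2-transitivity of the normalizer of a line, for pairs with first point `i`. -/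
theorem exists_mem_pointStabilizer (hS : SharpOnInvolutions G) (hR : CentralizersContainRoots G)
    (hi : i ∈ involutions G) (hj : j ∈ involutions G) (hij : i ≠ j) {a b : G}
    (ha : Commute a (i * j)) (hb : Commute b (i * j)) (ha1 : a ≠ 1) (hb1 : b ≠ 1) :
    ∃ h ∈ pointStabilizer i j, h * a * h⁻¹ = b := by
  have e : ∀ c : G, i * (i * c) = c := mul_mul_self_of_mem_involutions hi
  have hne : ∀ {c : G}, c ≠ 1 → i ≠ i * c := fun hc h => hc (by simpa using h)
  have hmem : ∀ {c : G}, Commute c (i * j) → i * c ∈ lineThrough (involutions G) i j := by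
    intro c hc
    rw [hS.mem_lineThrough_iff hi hj hij, e]
    exact ⟨hS.mul_mem_involutions hR hi hj hij hc, hc⟩
  obtain ⟨g, g1, g2⟩ := hS.trans i hi (i * a) (hmem ha).1 (hne ha1) i hi (i * b) (hmem hb).1
    (hne hb1)
  refine ⟨g, mem_pointStabilizer.2 ⟨?_, ?_⟩, ?_⟩
  · exact hS.mem_normalizer_of_conj_mem hR hi hj hij (left_mem_lineThrough hi hj) (hmem ha)
      (hne ha1) (by rw [g1]; exact left_mem_lineThrough hi hj) (by rw [g2]; exact hmem hb)
  · refine SemiconjBy.eq ?_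
    rw [SemiconjBy]
    nth_rewrite 2 [← g1]
    simp
  · rw [← e a, ← conj_mul, g1, g2, e]

theorem eq_one_of_mem_pointStabilizer (hS : SharpOnInvolutions G)
    (hR : CentralizersContainRoots G) (hi : i ∈ involutions G) (hj : j ∈ involutions G)
    (hij : i ≠ j) {h a : G} (hh : h ∈ pointStabilizer i j) (ha : Commute a (i * j)) (ha1 : a ≠ 1)
    (hah : Commute h a) : h = 1 := by
  have hhi := (mem_pointStabilizer.1 hh).2
  exact hS.free i hi (i * a) (hS.mul_mem_involutions hR hi hj hij ha)
    (fun e => ha1 (by simpa using e)) h hhi.eq (hhi.mul_right hah).eq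

/-- For nontrivial `h` fixing the point `i`, the endomorphism `x ↦ x ⬝ hx⁻¹h⁻¹` of the centralizer of
`ij` is onto. In terms of the maximal near-field, `x ↦ x - hx` is onto. -/
def CommutatorsSurjective (i j : G) : Prop :=
  ∀ h ∈ pointStabilizer i j, h ≠ 1 → ∀ c, Commute c (i * j) →
    ∃ x, Commute x (i * j) ∧ x * (h * x⁻¹ * h⁻¹) = c

theorem conjSet_eq_of_mem (hS : SharpOnInvolutions G) (hi : i ∈ involutions G)
    (hj : j ∈ involutions G) (hij : i ≠ j) {q : G}
    (hq : q ∈ lineThrough (involutions G) i j) :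
    conjSet (lineThrough (involutions G) i j) q = lineThrough (involutions G) i j := by
  have key : ∀ m ∈ lineThrough (involutions G) i j,
      q * m * q ∈ lineThrough (involutions G) i j := by
    intro m hm
    have h1 := hS.commute_mul_of_mem_lineThrough hi hj hij (left_mem_lineThrough hi hj) hq
    have h2 := hS.commute_mul_of_mem_lineThrough hi hj hij hm hq
    rw [hS.mem_lineThrough_iff hi hj hij]
    refine ⟨conj_involution_mem_involutions hm.1 hq.1, ?_⟩
    have : i * (q * m * q) = i * q * (m * q) := by simp only [mul_assoc]
    rw [this]
    exact h1.mul_left h2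
  ext m
  simp only [conjSet, Set.mem_image, inv_eq_self_of_mem_involutions hq.1]
  constructor
  · rintro ⟨n, hn, rfl⟩
    exact key n hn
  · exact fun hm => ⟨_, key m hm, conj_conj hq.1 m⟩

/-- If `p` and `q` reflect a line to the same line, then `qp` normalizes the line. By surjectivity of
`x ↦ x - hx`, an element of the normalizer without fixed points on the line is a translation along
it. Hence `qp` is such a translation, and it is inverted by `q`, so `q` lies on the line. -/
theorem reflect_of_commutatorsSurjective (hS : SharpOnInvolutions G)
    (hR : CentralizersContainRoots G) (hi : i ∈ involutions G) (hj : j ∈ involutions G)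
    (hij : i ≠ j) (hsurj : CommutatorsSurjective i j) {p q : G} (hp : p ∈ involutions G)
    (hq : q ∈ involutions G) (hpq : p ≠ q)
    (h : conjSet (lineThrough (involutions G) i j) p =
      conjSet (lineThrough (involutions G) i j) q) :
    conjSet (lineThrough (involutions G) i j) q = lineThrough (involutions G) i j := by
  have key : ∀ {p q : G}, p ∈ involutions G → q ∈ involutions G →
      conjSet (lineThrough (involutions G) i j) p = conjSet (lineThrough (involutions G) i j) q →
      ∀ m ∈ lineThrough (involutions G) i j,
        q * p * m * (q * p)⁻¹ ∈ lineThrough (involutions G) i j := by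
    intro p q hp hq h m hm
    have h1 : p * m * p ∈ conjSet (lineThrough (involutions G) i j) p :=
      ⟨m, hm, by simp only [inv_eq_self_of_mem_involutions hp]⟩
    rw [h] at h1
    obtain ⟨n, hn, h2⟩ := h1
    simp only [inv_eq_self_of_mem_involutions hq] at h2
    have : q * p * m * (q * p)⁻¹ = n := by
      rw [mul_inv_rev, inv_eq_self_of_mem_involutions hp, inv_eq_self_of_mem_involutions hq,
        ← conj_conj hq n, h2]
      simp only [mul_assoc]
    rwa [this]
  have hg : q * p ∈ Subgroup.normalizer (lineThrough (involutions G) i j) :=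
    hS.mem_normalizer_of_conj_mem hR hi hj hij (left_mem_lineThrough hi hj)
      (right_mem_lineThrough hi hj) hij (key hp hq h _ (left_mem_lineThrough hi hj))
      (key hp hq h _ (right_mem_lineThrough hi hj))
  obtain ⟨t, ht, x, hx, hg'⟩ := hS.exists_mul_eq_of_mem_normalizer hR hi hj hij hg
  by_cases hx1 : x = 1
  · rw [hx1, mul_one] at hg'
    rw [← hg'] at ht
    have hg1 : q * p ≠ 1 := by
      rw [Ne, mul_eq_one_iff_eq_inv, inv_eq_self_of_mem_involutions hp]
      exact hpq.symm
    refine hS.conjSet_eq_of_mem hi hj hij ((hS.mem_lineThrough_iff hi hj hij).2 ⟨hq, ?_⟩)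
    exact hS.commute_of_commute_of_ne_one hR hi hj hij ht hg1
      ((hS.conj_eq_inv hR hi hj hij ht).inv_swap.mul_left (semiconjBy_inv_mul hq hp))
  · obtain ⟨y, -, hy⟩ := hsurj x hx hx1 t ht
    -- The point `yiy⁻¹` is fixed by `qp`.
    exfalso
    refine hS.not_commute_mul hq hp hpq.symm (conj_mem_involutions hi y) ?_
    have h1 : SemiconjBy x i i := (mem_pointStabilizer.1 hx).2
    have h2 : SemiconjBy y⁻¹ (y * i * y⁻¹) i := by rw [SemiconjBy]; simp [mul_assoc]
    have h3 : SemiconjBy y i (y * i * y⁻¹) := by rw [SemiconjBy]; simp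
    have h4 := (h3.mul_left h1).mul_left h2
    have : y * x * y⁻¹ = q * p := by rw [hg', ← hy]; simp [mul_assoc]
    rwa [this] at h4

theorem exists_unique_midpoint (hS : SharpOnInvolutions G) (hi : i ∈ involutions G)
    (hj : j ∈ involutions G) : ∃! k, k ∈ involutions G ∧ k⁻¹ * i * k = j := by
  by_cases hij : i = j
  · subst hij
    refine ⟨i, ⟨hi, by simp⟩, ?_⟩
    rintro k ⟨hk, h⟩
    rw [inv_eq_self_of_mem_involutions hk] at h
    exact hS.eq_of_commute hk hi (semiconjBy_of_conj_eq hk h)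
  · obtain ⟨k, hk, h⟩ := hS.exists_swap hi hj hij
    refine ⟨k, ⟨hk, by rwa [inv_eq_self_of_mem_involutions hk]⟩, ?_⟩
    rintro l ⟨hl, h'⟩
    rw [inv_eq_self_of_mem_involutions hl] at h'
    exact hS.eq_of_swap hl hk hi hj hij h' h

/-- The axioms other than those on lines hold in every sharply 2-transitive group in which
involutions have fixed points. -/
theorem formsMockHyperbolic_of_lines (hS : SharpOnInvolutions G)
    (hline : ∀ i ∈ involutions G, ∀ j ∈ involutions G, i ≠ j →
      ∀ k ∈ lineThrough (involutions G) i j, ∀ l ∈ lineThrough (involutions G) i j, k ≠ l →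
        lineThrough (involutions G) i j = lineThrough (involutions G) k l)
    (hrefl : ∀ i ∈ involutions G, ∀ j ∈ involutions G, i ≠ j →
      ∀ p ∈ involutions G, ∀ q ∈ involutions G, p ≠ q →
        conjSet (lineThrough (involutions G) i j) p =
          conjSet (lineThrough (involutions G) i j) q →
        conjSet (lineThrough (involutions G) i j) q = lineThrough (involutions G) i j) :
    FormsMockHyperbolic (involutions G) where
  conj_class := by
    obtain ⟨i, hi⟩ := hS.nonempty
    refine ⟨i, hi, ?_⟩
    ext j
    change _ ↔ IsConj i j
    rw [isConj_iff]
    constructor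
    · intro hj
      obtain ⟨k, ⟨-, h⟩, -⟩ := hS.exists_unique_midpoint hi hj
      exact ⟨k⁻¹, by rw [← h, inv_inv]⟩
    · rintro ⟨g, rfl⟩
      exact conj_mem_involutions hi g
  line_subset := by
    rintro l ⟨i, -, j, -, -, rfl⟩ k hk
    exact hk.1
  line_nontrivial := by
    rintro l ⟨i, hi, j, hj, hij, rfl⟩
    exact ⟨i, left_mem_lineThrough hi hj, j, right_mem_lineThrough hi hj, hij⟩
  invariant := by
    rintro l ⟨i, hi, j, hj, hij, rfl⟩ g
    refine ⟨g⁻¹ * i * g⁻¹⁻¹, conj_mem_involutions hi _, g⁻¹ * j * g⁻¹⁻¹, conj_mem_involutions hj _,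
      fun h => hij (by simpa using h), ?_⟩
    ext m
    simp only [conjSet, Set.mem_image]
    constructor
    · rintro ⟨n, hn, rfl⟩
      simpa using conj_mem_lineThrough g⁻¹ n hn
    · intro hm
      refine ⟨g * m * g⁻¹, ?_, by simp [mul_assoc]⟩
      rw [← conj_mem_lineThrough_iff g⁻¹]
      simpa [mul_assoc] using hm
  line_eq := by
    rintro l ⟨i, hi, j, hj, hij, rfl⟩ k hk m hm hkm
    exact hline i hi j hj hij k hk m hm hkm
  midpoint := fun i hi j hj => hS.exists_unique_midpoint hi hj
  reflect := by
    rintro l ⟨i, hi, j, hj, hij, rfl⟩ p hp q hq hpq h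
    have := hrefl i hi j hj hij p hp q hq hpq h
    exact ⟨h.trans this, this⟩
  line_exists := fun i hi j hj hij => ⟨i, hi, j, hj, hij, rfl⟩

theorem formsMockHyperbolic (hS : SharpOnInvolutions G) (hR : CentralizersContainRoots G)
    (hsurj : ∀ i ∈ involutions G, ∀ j ∈ involutions G, i ≠ j → CommutatorsSurjective i j) :
    FormsMockHyperbolic (involutions G) :=
  hS.formsMockHyperbolic_of_lines
    (fun _ hi _ hj hij _ hk _ hl hkl => hS.lineThrough_eq hR hi hj hij hk hl hkl)
    (fun i hi j hj hij _ hp _ hq hpq h =>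
      hS.reflect_of_commutatorsSurjective hR hi hj hij (hsurj i hi j hj hij) hp hq hpq h)

end SharpOnInvolutions
end CentralizersOfTranslations

/-! ### The near-field of a line -/

section MaximalNearField

namespace SharpOnInvolutions

variable {G : Type u} [Group G] {i j : G}

/-- The parametrization of the centralizer of `ij` by the stabilizer of `i` with a zero adjoined:
`h ↦ h(ij)h⁻¹` and `0 ↦ 1`. -/
def translationOf (i j : G) (x : WithZero (pointStabilizer i j)) : G :=
  WithZero.recZeroCoe (motive := fun _ => G) 1 (fun h => h * (i * j) * (h : G)⁻¹) x

theorem commute_translationOf (hS : SharpOnInvolutions G) (hR : CentralizersContainRoots G)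
    (hi : i ∈ involutions G) (hj : j ∈ involutions G) (hij : i ≠ j)
    (x : WithZero (pointStabilizer i j)) : Commute (translationOf i j x) (i * j) := by
  cases x using WithZero.recZeroCoe with
  | zero => exact Commute.one_left _
  | coe h =>
    exact hS.commute_conj_of_mem_normalizer hR hi hj hij (mem_pointStabilizer.1 h.2).1
      (Commute.refl _)

theorem mul_ne_one_of_ne (hj : j ∈ involutions G) (hij : i ≠ j) :
    i * j ≠ 1 := by
  rwa [Ne, mul_eq_one_iff_eq_inv, inv_eq_self_of_mem_involutions hj]

/-- The stabilizer of `i` acts regularly on the nontrivial elements of the centralizer of `ij`. -/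
noncomputable def translationEquiv (hS : SharpOnInvolutions G) (hR : CentralizersContainRoots G)
    (hi : i ∈ involutions G) (hj : j ∈ involutions G) (hij : i ≠ j) :
    WithZero (pointStabilizer i j) ≃ Subgroup.centralizer {i * j} :=
  Equiv.ofBijective
    (fun x => ⟨translationOf i j x, Subgroup.mem_centralizer_singleton_iff.2
      (hS.commute_translationOf hR hi hj hij x).eq⟩) <| by
    have hσ := mul_ne_one_of_ne hj hij
    constructor
    · intro x y hxy
      replace hxy : translationOf i j x = translationOf i j y := congrArg Subtype.val hxy
      have hne : ∀ h : G, h * (i * j) * h⁻¹ ≠ 1 := fun h e => hσ (by simpa using e)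
      cases x using WithZero.recZeroCoe with
      | zero =>
        cases y using WithZero.recZeroCoe with
        | zero => rfl
        | coe k => exact absurd hxy.symm (hne k)
      | coe h =>
        cases y using WithZero.recZeroCoe with
        | zero => exact absurd hxy (hne h)
        | coe k =>
          replace hxy : h * (i * j) * (h : G)⁻¹ = k * (i * j) * (k : G)⁻¹ := hxy
          have h1 : ((k⁻¹ * h : pointStabilizer i j) : G) = 1 := by
            refine hS.eq_one_of_mem_pointStabilizer hR hi hj hij (k⁻¹ * h).2 (Commute.refl _) hσ
              (SemiconjBy.eq ?_)
            have h2 : h * (i * j) = k * (i * j) * (k : G)⁻¹ * h := by rw [← hxy]; simp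
            push_cast
            rw [SemiconjBy, mul_assoc, h2]
            simp [mul_assoc]
          rw [inv_mul_eq_one.1 (Subtype.ext h1)]
    · rintro ⟨a, ha⟩
      rw [Subgroup.mem_centralizer_singleton_iff] at ha
      by_cases ha1 : a = 1
      · exact ⟨0, Subtype.ext ha1.symm⟩
      · obtain ⟨h, hh, e⟩ := hS.exists_mem_pointStabilizer hR hi hj hij (Commute.refl _) ha hσ ha1
        exact ⟨((⟨h, hh⟩ : pointStabilizer i j) : WithZero (pointStabilizer i j)), Subtype.ext e⟩

section

variable (hS : SharpOnInvolutions G) (hR : CentralizersContainRoots G)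
    (hi : i ∈ involutions G) (hj : j ∈ involutions G) (hij : i ≠ j)

theorem translationEquiv_zero : hS.translationEquiv hR hi hj hij 0 = 1 := rfl

theorem coe_translationEquiv_coe_mul (h : pointStabilizer i j)
    (x : WithZero (pointStabilizer i j)) :
    (hS.translationEquiv hR hi hj hij (h * x) : G) =
      h * hS.translationEquiv hR hi hj hij x * (h : G)⁻¹ := by
  cases x using WithZero.recZeroCoe with
  | zero => simp [translationEquiv_zero]
  | coe k =>
    change ((h * k : pointStabilizer i j) : G) * (i * j) * ((h * k : pointStabilizer i j) : G)⁻¹ =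
      h * (k * (i * j) * (k : G)⁻¹) * (h : G)⁻¹
    simp [mul_assoc]

theorem commute_translationEquiv (x : WithZero (pointStabilizer i j)) :
    Commute (hS.translationEquiv hR hi hj hij x : G) (i * j) :=
  Subgroup.mem_centralizer_singleton_iff.1 (hS.translationEquiv hR hi hj hij x).2

/-- The near-field of the line through `i` and `j`. The addition is that of the centralizer of `ij`,
the multiplicative group is the stabilizer of `i`, acting by conjugation, and `ij` is the unit
element. -/
@[reducible] noncomputable def lineNearField : NearField (WithZero (pointStabilizer i j)) :=
  let e := hS.translationEquiv hR hi hj hij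
  { (inferInstance : GroupWithZero (WithZero (pointStabilizer i j))) with
    add := fun x y => e.symm (e x * e y)
    add_assoc := fun x y z => by
      change e.symm (e (e.symm (e x * e y)) * e z) = e.symm (e x * e (e.symm (e y * e z)))
      simp only [Equiv.apply_symm_apply, mul_assoc]
    zero_add := fun x => by
      change e.symm (e 0 * e x) = x
      rw [translationEquiv_zero, one_mul, Equiv.symm_apply_apply]
    add_zero := fun x => by
      change e.symm (e x * e 0) = x
      rw [translationEquiv_zero, mul_one, Equiv.symm_apply_apply]
    nsmul := @nsmulRec _ ⟨0⟩ ⟨fun x y => e.symm (e x * e y)⟩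
    neg := fun x => e.symm (e x)⁻¹
    zsmul := @zsmulRec _ ⟨0⟩ ⟨fun x y => e.symm (e x * e y)⟩ ⟨fun x => e.symm (e x)⁻¹⟩
      (@nsmulRec _ ⟨0⟩ ⟨fun x y => e.symm (e x * e y)⟩)
    neg_add_cancel := fun x => by
      change e.symm (e (e.symm (e x)⁻¹) * e x) = 0
      rw [Equiv.apply_symm_apply, inv_mul_cancel, Equiv.symm_apply_eq, translationEquiv_zero]
    left_distrib' := fun a b c => by
      change a * e.symm (e b * e c) = e.symm (e (a * b) * e (a * c))
      cases a using WithZero.recZeroCoe with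
      | zero =>
        simp only [zero_mul]
        rw [eq_comm, Equiv.symm_apply_eq, translationEquiv_zero, mul_one]
      | coe h =>
        rw [Equiv.eq_symm_apply]
        refine Subtype.ext ?_
        rw [Subgroup.coe_mul, coe_translationEquiv_coe_mul, coe_translationEquiv_coe_mul,
          coe_translationEquiv_coe_mul, Equiv.apply_symm_apply, Subgroup.coe_mul, conj_mul] }

theorem coe_translationEquiv_add (x y : WithZero (pointStabilizer i j)) :
    letI := hS.lineNearField hR hi hj hij
    (hS.translationEquiv hR hi hj hij (x + y) : G) =
      hS.translationEquiv hR hi hj hij x * hS.translationEquiv hR hi hj hij y :=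
  congrArg Subtype.val ((hS.translationEquiv hR hi hj hij).apply_symm_apply _)

/-- The centralizer of `ij` acts regularly on the line through `i` and `j`. -/
noncomputable def pointEquiv :
    WithZero (pointStabilizer i j) ≃ lineThrough (involutions G) i j :=
  (hS.translationEquiv hR hi hj hij).trans <| Equiv.ofBijective
    (fun t => ⟨t * i * (t : G)⁻¹,
      (hS.mem_normalizer_of_commute hR hi hj hij
        (Subgroup.mem_centralizer_singleton_iff.1 t.2) i).1 (left_mem_lineThrough hi hj)⟩) <| by
    constructor
    · intro s t h
      exact Subtype.ext (hS.eq_of_conj_eq hi hj hij (Subgroup.mem_centralizer_singleton_iff.1 s.2)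
        (Subgroup.mem_centralizer_singleton_iff.1 t.2) (congrArg Subtype.val h))
    · rintro ⟨m, hm⟩
      obtain ⟨t, ht, e⟩ := hS.exists_commute_conj_eq hR hi hj hij hm
      exact ⟨⟨t, Subgroup.mem_centralizer_singleton_iff.2 ht.eq⟩, Subtype.ext e⟩

theorem coe_pointEquiv (x : WithZero (pointStabilizer i j)) :
    (hS.pointEquiv hR hi hj hij x : G) = hS.translationEquiv hR hi hj hij x * i *
      (hS.translationEquiv hR hi hj hij x : G)⁻¹ := rfl

/-- An element `th` of the normalizer acts on the line as the affine map `z ↦ t + hz`. -/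
theorem normalizerConj_pointEquiv (b x : WithZero (pointStabilizer i j))
    (h : pointStabilizer i j)
    (g : Subgroup.normalizer (lineThrough (involutions G) i j))
    (hg : (g : G) = hS.translationEquiv hR hi hj hij b * h) :
    letI := hS.lineNearField hR hi hj hij
    normalizerConj _ g (hS.pointEquiv hR hi hj hij x) =
      hS.pointEquiv hR hi hj hij (b + (h : WithZero (pointStabilizer i j)) * x) := by
  let := hS.lineNearField hR hi hj hij
  refine Subtype.ext ?_
  rw [coe_pointEquiv, coe_translationEquiv_add]
  erw [coe_translationEquiv_coe_mul]
  change (g : G) * hS.pointEquiv hR hi hj hij x * (g : G)⁻¹ = _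
  rw [coe_pointEquiv, hg]
  have key : ∀ t h x : G, Commute h i →
      t * h * (x * i * x⁻¹) * (t * h)⁻¹ = t * (h * x * h⁻¹) * i * (t * (h * x * h⁻¹))⁻¹ := by
    intro t h x hhi
    have e : h⁻¹ * (i * h) = i := by rw [← hhi.eq, inv_mul_cancel_left]
    nth_rewrite 1 [← e]
    simp only [mul_inv_rev, mul_assoc, inv_inv]
  exact key _ _ _ (mem_pointStabilizer.1 h.2).2

/-- The normalizer of a line, acting on the line, is a split sharply 2-transitive group. -/
theorem isMaximalNearField_lineNearField :
    letI := hS.lineNearField hR hi hj hij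
    IsMaximalNearField G (WithZero (pointStabilizer i j)) := by
  let := hS.lineNearField hR hi hj hij
  refine ⟨i, hi, j, hj, hij, ?_⟩
  set ℓ := lineThrough (involutions G) i j with hℓ
  let e := hS.pointEquiv hR hi hj hij
  let ψ : Subgroup.normalizer ℓ →* Equiv.Perm (WithZero (pointStabilizer i j)) :=
    e.symm.permCongrHom.toMonoidHom.comp (normalizerConj ℓ)
  have hψ : ∀ g x, ψ g x = e.symm (normalizerConj ℓ g (e x)) := fun g x => rfl
  have hmem : ∀ g, ψ g ∈ NearField.affineGroup (WithZero (pointStabilizer i j)) := by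
    intro g
    obtain ⟨t, ht, h, hh, hg⟩ := hS.exists_mul_eq_of_mem_normalizer hR hi hj hij g.2
    refine ⟨((⟨h, hh⟩ : pointStabilizer i j) : WithZero (pointStabilizer i j)),
      (hS.translationEquiv hR hi hj hij).symm
        ⟨t, Subgroup.mem_centralizer_singleton_iff.2 ht.eq⟩, WithZero.coe_ne_zero, fun z => ?_⟩
    rw [hψ, Equiv.symm_apply_eq]
    exact hS.normalizerConj_pointEquiv hR hi hj hij _ _ _ _ (by simpa using hg)
  refine ⟨MulEquiv.ofBijective (ψ.codRestrict _ hmem) ⟨?_, ?_⟩, e.symm, ?_⟩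
  · rw [injective_iff_map_eq_one]
    intro g hg
    have hg1 : ∀ m (hm : m ∈ ℓ), (g : G) * m = m * g := by
      intro m hm
      have h1 : ψ g = 1 := congrArg Subtype.val hg
      have h2 := congrArg (fun f : Equiv.Perm _ => ((e (f (e.symm ⟨m, hm⟩))) : G)) h1
      simp only [hψ, Equiv.apply_symm_apply, Equiv.Perm.one_apply] at h2
      replace h2 : (g : G) * m * (g : G)⁻¹ = m := h2
      nth_rewrite 2 [← h2]
      simp
    exact Subtype.ext (hS.free i hi j hj hij g (hg1 i (left_mem_lineThrough hi hj))
      (hg1 j (right_mem_lineThrough hi hj)))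
  · rintro ⟨f, a, b, ha, hf⟩
    cases a using WithZero.recZeroCoe with
    | zero => exact absurd rfl ha
    | coe h =>
      refine ⟨⟨hS.translationEquiv hR hi hj hij b * h, mul_mem
        (hS.mem_normalizer_of_commute hR hi hj hij (hS.commute_translationEquiv hR hi hj hij b))
        (mem_pointStabilizer.1 h.2).1⟩, Subtype.ext (Equiv.ext fun z => ?_)⟩
      rw [hf]
      change ψ _ z = _
      rw [hψ, Equiv.symm_apply_eq]
      exact hS.normalizerConj_pointEquiv hR hi hj hij _ _ _ _ rfl
  · intro g m
    change e.symm (normalizerConj ℓ g m) = ψ g (e.symm m)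
    rw [hψ, Equiv.apply_symm_apply]

end

theorem commutatorsSurjective_of_isPlanar (hS : SharpOnInvolutions G)
    (hR : CentralizersContainRoots G) (hi : i ∈ involutions G) (hj : j ∈ involutions G)
    (hij : i ≠ j) (hpl : MaximalNearFieldIsPlanar G) :
    CommutatorsSurjective i j := by
  let := hS.lineNearField hR hi hj hij
  intro h hh hh1 c hc
  have hne : (1 : WithZero (pointStabilizer i j)) ≠ ((⟨h, hh⟩ : pointStabilizer i j) : _) := by
    intro e
    rw [eq_comm, ← WithZero.coe_one, WithZero.coe_inj] at e
    exact hh1 (congrArg Subtype.val e)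
  let c' : Subgroup.centralizer {i * j} := ⟨c, Subgroup.mem_centralizer_singleton_iff.2 hc.eq⟩
  obtain ⟨z, hz, -⟩ := hpl (WithZero (pointStabilizer i j))
    (hS.isMaximalNearField_lineNearField hR hi hj hij) 1 _
    ((hS.translationEquiv hR hi hj hij).symm c') hne
  have hz' := congrArg (fun x => (hS.translationEquiv hR hi hj hij x : G)) hz
  have hcz := hS.commute_translationEquiv hR hi hj hij z
  simp only [coe_translationEquiv_add] at hz'
  rw [one_mul, Equiv.apply_symm_apply] at hz'
  erw [coe_translationEquiv_coe_mul] at hz'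
  set x : G := ((hS.translationEquiv hR hi hj hij z : Subgroup.centralizer {i * j}) : G)
  refine ⟨x, hcz, ?_⟩
  have hx := hS.commute_conj_of_mem_normalizer hR hi hj hij (mem_pointStabilizer.1 hh).1 hcz
  have e : h * x⁻¹ * h⁻¹ = (h * x * h⁻¹)⁻¹ := by simp [mul_assoc]
  rw [e, (hS.commute_of_commute hR hi hj hij hcz hx.inv_left).eq]
  nth_rewrite 2 [hz']
  exact inv_mul_cancel_left _ _

end SharpOnInvolutions
end MaximalNearField

/-! ### Definable subgroups in finite Morley rank -/

section MorleyRank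

open FirstOrder FirstOrder.Language

variable {L : FirstOrder.Language.{v, w}} {M : Type*} {N : Type*} [L.Structure M] [L.Structure N]

theorem MorleyRankGE.mono {n : ℕ} {s t : Set M} (h : MorleyRankGE L M n s) (hst : s ⊆ t) :
    MorleyRankGE L M n t := by
  cases n with
  | zero => exact Set.Nonempty.mono hst h
  | succ n =>
    obtain ⟨u, hu, h⟩ := h
    exact ⟨u, hu, fun k => ⟨(h k).1.trans hst, (h k).2⟩⟩

theorem definable₁_univ_iff {s : Set M} : (Set.univ : Set M).Definable₁ L s ↔
    ∃ φ : L.Formula (M ⊕ Fin 1), s = {x | φ.Realize (Sum.elim id fun _ => x)} := by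
  rw [Set.Definable₁, Set.definable_iff_exists_formula_sum]
  constructor
  · rintro ⟨φ, hφ⟩
    refine ⟨φ.relabel (Sum.map Subtype.val id), ?_⟩
    ext x
    have h := Set.ext_iff.1 hφ fun _ => x
    simp only [Set.mem_ofPred_eq] at h
    rw [Set.mem_ofPred_eq, h, Formula.realize_relabel]
    congr! 1
    ext y
    rcases y with y | y <;> rfl
  · rintro ⟨φ, rfl⟩
    refine ⟨φ.relabel (Sum.map (fun m => ⟨m, trivial⟩) id), ?_⟩
    ext x
    rw [Set.mem_ofPred_eq, Set.mem_ofPred_eq, Set.mem_ofPred_eq, Formula.realize_relabel]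
    congr! 1
    ext y
    rcases y with y | y
    · rfl
    · exact congrArg x (Subsingleton.elim _ _)

theorem forall_fin_one {P : Type*} {p : (Fin 1 → P) → Prop} :
    (∀ i, p i) ↔ ∀ x, p fun _ => x := by
  refine ⟨fun h x => h _, fun h i => ?_⟩
  have : i = fun _ => i 0 := funext fun k => congrArg i (Subsingleton.elim _ _)
  rw [this]
  exact h _

namespace FirstOrder.Language.ElementaryEmbedding

/-- The set defined in `N` by a formula with parameters from `M`. -/
def definedSet (f : M ↪ₑ[L] N) (φ : L.Formula (M ⊕ Fin 1)) : Set N :=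
  {x | φ.Realize (Sum.elim f fun _ => x)}

theorem definable₁_definedSet (f : M ↪ₑ[L] N) (φ : L.Formula (M ⊕ Fin 1)) :
    (Set.univ : Set N).Definable₁ L (f.definedSet φ) := by
  rw [definable₁_univ_iff]
  refine ⟨φ.relabel (Sum.map f id), ?_⟩
  ext x
  rw [definedSet, Set.mem_ofPred_eq, Set.mem_ofPred_eq, Formula.realize_relabel]
  congr! 1
  ext y
  rcases y with y | y <;> rfl

theorem forall_mem_definedSet_iff (f : M ↪ₑ[L] N) (φ : L.Formula (M ⊕ Fin 1)) :
    (∀ x, x ∈ f.definedSet φ) ↔ ∀ x, x ∈ (refl L M).definedSet φ := by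
  have hM := Formula.realize_iAlls (M := M) (β := Fin 1) (φ := φ) (v := id)
  have hN := Formula.realize_iAlls (M := N) (β := Fin 1) (φ := φ) (v := f)
  have h := f.map_formula (φ.iAlls (Fin 1)) id
  rw [Function.comp_id, hM, hN] at h
  rw [forall_fin_one, forall_fin_one] at h
  exact h

theorem definedSet_subset_iff (f : M ↪ₑ[L] N) (φ ψ : L.Formula (M ⊕ Fin 1)) :
    f.definedSet φ ⊆ f.definedSet ψ ↔ (refl L M).definedSet φ ⊆ (refl L M).definedSet ψ := by
  have h := f.forall_mem_definedSet_iff (φ.imp ψ)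
  simpa only [definedSet, Set.mem_ofPred_eq, Formula.realize_imp, Set.subset_def] using h

theorem disjoint_definedSet_iff (f : M ↪ₑ[L] N) (φ ψ : L.Formula (M ⊕ Fin 1)) :
    Disjoint (f.definedSet φ) (f.definedSet ψ) ↔
      Disjoint ((refl L M).definedSet φ) ((refl L M).definedSet ψ) := by
  have h := f.forall_mem_definedSet_iff (φ.imp ψ.not)
  simpa only [definedSet, Set.mem_ofPred_eq, Formula.realize_imp, Formula.realize_not,
    Set.disjoint_left] using h

theorem definedSet_nonempty_iff (f : M ↪ₑ[L] N) (φ : L.Formula (M ⊕ Fin 1)) :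
    (f.definedSet φ).Nonempty ↔ ((refl L M).definedSet φ).Nonempty := by
  have h := not_congr (f.forall_mem_definedSet_iff φ.not)
  simpa only [definedSet, Set.mem_ofPred_eq, Formula.realize_not, not_forall, not_not,
    Set.Nonempty] using h

/-- The rank of a definable set does not drop in an elementary extension. -/
theorem morleyRankGE_definedSet (f : M ↪ₑ[L] N) (n : ℕ) (φ : L.Formula (M ⊕ Fin 1))
    (h : MorleyRankGE L M n ((refl L M).definedSet φ)) :
    MorleyRankGE L N n (f.definedSet φ) := by
  induction n generalizing φ with
  | zero => exact (f.definedSet_nonempty_iff φ).2 h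
  | succ n ih =>
    obtain ⟨t, ht, hts⟩ := h
    choose ψ hψ using fun k => definable₁_univ_iff.1 (hts k).2.1
    replace hψ : ∀ k, t k = (refl L M).definedSet (ψ k) := hψ
    refine ⟨fun k => f.definedSet (ψ k), fun k l hkl => ?_, fun k => ⟨?_, ?_, ?_⟩⟩
    · have : Disjoint (t k) (t l) := ht hkl
      rw [hψ, hψ] at this
      exact (f.disjoint_definedSet_iff _ _).2 this
    · have := (hts k).1
      rw [hψ] at this
      exact (f.definedSet_subset_iff _ _).2 this
    · exact f.definable₁_definedSet _
    · have := (hts k).2.2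
      rw [hψ] at this
      exact ih _ this

end FirstOrder.Language.ElementaryEmbedding

theorem HasFiniteMorleyRank.exists_not_morleyRankGE {M : Type u} [L.Structure M]
    (h : HasFiniteMorleyRank L M) : ∃ n, ¬ MorleyRankGE L M n Set.univ := by
  obtain ⟨N, _, f, -, n, hn⟩ := h
  refine ⟨n, fun h => hn ?_⟩
  refine (f.morleyRankGE_definedSet n ⊤ (h.mono fun x _ => ?_)).mono (Set.subset_univ _)
  exact Formula.realize_top.2 trivial

end MorleyRank

section DefinableSubgroups

open FirstOrder FirstOrder.Language

variable {L : FirstOrder.Language.{v, w}} {G : Type u} [Group G] [L.Structure G]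

theorem IsGroupOfFiniteMorleyRank.definableFun_mul (hL : IsGroupOfFiniteMorleyRank L G)
    {α : Type*} [Finite α] {f g : (α → G) → G} (hf : (Set.univ : Set G).DefinableFun L f)
    (hg : (Set.univ : Set G).DefinableFun L g) :
    (Set.univ : Set G).DefinableFun L fun v => f v * g v := by
  have hsome : (Set.univ : Set G).DefinableMap L fun w : Option α → G => w ∘ some :=
    fun i => Set.DefinableFun.proj L
  have h : (Set.univ : Set G).DefinableMap L
      fun w : Option α → G => ![f (w ∘ some), g (w ∘ some), w none] := by
    intro k
    fin_cases k
    · exact hf.comp hsome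
    · exact hg.comp hsome
    · exact Set.DefinableFun.proj L
  exact hL.mul_definable.preimage_map h

theorem IsGroupOfFiniteMorleyRank.definable₁_centralizer (hL : IsGroupOfFiniteMorleyRank L G)
    (c : G) : (Set.univ : Set G).Definable₁ L (Subgroup.centralizer {c} : Set G) := by
  have hx : (Set.univ : Set G).DefinableFun L fun v : Fin 1 → G => v 0 := Set.DefinableFun.proj L
  have hc := definableFun_const L (Fin 1) (Set.mem_univ c)
  have h := (hL.definableFun_mul hx hc).ofPred_eq (hL.definableFun_mul hc hx)
  simpa only [Set.Definable₁, SetLike.mem_coe, Subgroup.mem_centralizer_singleton_iff] using h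

theorem IsGroupOfFiniteMorleyRank.definable₁_coset (hL : IsGroupOfFiniteMorleyRank L G)
    {s : Set G} (hs : (Set.univ : Set G).Definable₁ L s) (c : G) :
    (Set.univ : Set G).Definable₁ L {x | c * x ∈ s} := by
  have h : (Set.univ : Set G).DefinableMap L fun (v : Fin 1 → G) (_ : Fin 1) => c * v 0 :=
    fun _ => hL.definableFun_mul (definableFun_const L (Fin 1) (Set.mem_univ c))
      (Set.DefinableFun.proj L)
  exact Set.Definable.preimage_map h hs

theorem IsGroupOfFiniteMorleyRank.definable₁_commutators (hL : IsGroupOfFiniteMorleyRank L G)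
    {s : Set G} (hs : (Set.univ : Set G).Definable₁ L s) (h : G) :
    (Set.univ : Set G).Definable₁ L {y | ∃ x ∈ s, x * (h * x⁻¹ * h⁻¹) = y} := by
  have hx : (Set.univ : Set G).DefinableFun L fun v : Fin 2 → G => v 0 := Set.DefinableFun.proj L
  have hy : (Set.univ : Set G).DefinableFun L fun v : Fin 2 → G => v 1 := Set.DefinableFun.proj L
  have hc := definableFun_const L (Fin 2) (Set.mem_univ h)
  have h1 := (hL.definableFun_mul hx hc).ofPred_eq
    (hL.definableFun_mul hy (hL.definableFun_mul hc hx))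
  have h2 : (Set.univ : Set G).Definable L {v : Fin 2 → G | v 0 ∈ s} :=
    Set.Definable.preimage_map (F := fun (v : Fin 2 → G) (_ : Fin 1) => v 0) (fun _ => hx) hs
  have h3 := (h2.inter h1).image_comp (fun _ : Fin 1 => (1 : Fin 2))
  unfold Set.Definable₁
  convert h3 using 1
  have e : ∀ x y : G, x * (h * x⁻¹ * h⁻¹) = y ↔ x * h = y * (h * x) := by
    intro x y
    constructor
    · rintro rfl
      simp [mul_assoc]
    · intro e
      rw [← mul_assoc, ← mul_assoc, e]
      simp [mul_assoc]
  ext v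
  simp only [Set.mem_ofPred_eq, Set.mem_image, Set.mem_inter_iff, e]
  constructor
  · rintro ⟨x, hx, hxv⟩
    refine ⟨![x, v 0], ⟨hx, hxv⟩, ?_⟩
    ext k
    rw [Subsingleton.elim k 0]
    rfl
  · rintro ⟨w, ⟨hw1, hw2⟩, rfl⟩
    exact ⟨w 0, hw1, hw2⟩

/-- In a strictly descending chain `H₀ > H₁ > ⋯` of definable subgroups, `Hₘ` contains the disjoint
cosets `gₖHₖ₊₁ ⊆ Hₖ ∖ Hₖ₊₁`, `k ≥ m`. Inductively, all cosets of all `Hₘ` have rank at least `n`. -/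
theorem IsGroupOfFiniteMorleyRank.morleyRankGE_coset (hL : IsGroupOfFiniteMorleyRank L G)
    {H : ℕ → Subgroup G} (hH : ∀ n, (Set.univ : Set G).Definable₁ L (H n : Set G))
    (hanti : StrictAnti H) (n m : ℕ) (g : G) : MorleyRankGE L G n {x | g⁻¹ * x ∈ H m} := by
  induction n generalizing m g with
  | zero => exact ⟨g, by simp⟩
  | succ n ih =>
    choose c hc hc' using fun k => SetLike.exists_of_lt (hanti (Nat.lt_succ_self k))
    have mem : ∀ {k x}, (g * c k)⁻¹ * x ∈ H (k + 1) → g⁻¹ * x ∈ H k := by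
      intro k x hx
      have := mul_mem (hc k) (hanti.antitone (Nat.le_succ k) hx)
      simpa [mul_assoc] using this
    have disj : ∀ {k l}, k < l → Disjoint {x | (g * c (m + k))⁻¹ * x ∈ H (m + k + 1)}
        {x | (g * c (m + l))⁻¹ * x ∈ H (m + l + 1)} := by
      intro k l hkl
      rw [Set.disjoint_left]
      intro x h1 h2
      have h3 : g⁻¹ * x ∈ H (m + k + 1) := hanti.antitone (by omega) (mem h2)
      have h4 := mul_mem h3 (inv_mem h1)
      refine hc' (m + k) ?_
      simpa [mul_assoc] using h4
    refine ⟨fun k => {x | (g * c (m + k))⁻¹ * x ∈ H (m + k + 1)}, fun k l hkl => ?_,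
      fun k => ⟨fun x hx => ?_, hL.definable₁_coset (hH _) _, ih _ _⟩⟩
    · rcases lt_or_gt_of_ne hkl with h | h
      · exact disj h
      · exact (disj h).symm
    · exact hanti.antitone (Nat.le_add_right m k) (mem hx)

/-- The descending chain condition for definable subgroups. -/
theorem IsGroupOfFiniteMorleyRank.not_strictAnti (hL : IsGroupOfFiniteMorleyRank L G)
    {H : ℕ → Subgroup G} (hH : ∀ n, (Set.univ : Set G).Definable₁ L (H n : Set G)) :
    ¬ StrictAnti H := by
  intro hanti
  obtain ⟨n, hn⟩ := hL.finite_rank.exists_not_morleyRankGE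
  exact hn ((hL.morleyRankGE_coset hH hanti n 0 1).mono (Set.subset_univ _))

end DefinableSubgroups

/-! ### Split groups over planar near-fields -/

section SplitGroups

theorem NearField.neg_one_mul_neg_one {K : Type*} [NearField K] : (-1 : K) * -1 = 1 := by
  rw [NearField.mul_neg', mul_one, neg_neg]

theorem NearField.neg_one_ne_one {K : Type*} [NearField K] (hK : addOrderOf (1 : K) ≠ 2) :
    (-1 : K) ≠ 1 := by
  intro h
  refine hK (addOrderOf_eq_prime ?_ one_ne_zero)
  rw [two_nsmul]
  nth_rewrite 1 [← h]
  exact neg_add_cancel 1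

/-- In a planar near-field, an affine map without fixed points is a translation. The addition is not
assumed to be commutative, hence the detour through `-x`. -/
theorem NearField.IsPlanar.eq_one_of_forall_ne {K : Type*} [NearField K]
    (hK : NearField.IsPlanar K) {a b : K} (h : ∀ z, b + a * z ≠ z) : a = 1 := by
  by_contra ha
  obtain ⟨x, hx, -⟩ := hK 1 a (-b) (Ne.symm ha)
  rw [one_mul] at hx
  refine h (-x) ?_
  rw [NearField.mul_neg']
  nth_rewrite 2 [hx]
  rw [neg_add_rev, neg_neg]

variable {G X K : Type*} [Group G] [MulAction G X] [NearField K]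

/-- The involution `z ↦ -1 ⬝ z` fixes `0`. -/
theorem CorrespondsToNearField.not_involutionsFixNoPoint
    (hc : CorrespondsToNearField (MulAction.toPermHom G X) K) (hK : addOrderOf (1 : K) ≠ 2) :
    ¬ InvolutionsFixNoPoint G X := by
  obtain ⟨φ, e, he⟩ := hc
  have hm : (-1 : K) ≠ 0 := fun h => by
    have := NearField.neg_one_mul_neg_one (K := K)
    rw [h, zero_mul] at this
    exact zero_ne_one this
  let f : NearField.affineGroup K := ⟨Equiv.mulLeft₀ (-1) hm, -1, 0, hm, fun z => by simp⟩
  have hf : ∀ z, (f : Equiv.Perm K) z = -1 * z := fun z => rfl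
  intro h
  refine h (φ.symm f) ⟨fun h1 => ?_, ?_⟩ (e.symm 0) ?_
  · rw [MulEquiv.symm_apply_eq, map_one] at h1
    have := hf 1
    rw [h1, mul_one] at this
    exact NearField.neg_one_ne_one hK this.symm
  · rw [← map_mul, MulEquiv.symm_apply_eq, map_one]
    refine Subtype.ext (Equiv.ext fun z => ?_)
    rw [Subgroup.coe_mul, Equiv.Perm.mul_apply, hf, hf, ← mul_assoc,
      NearField.neg_one_mul_neg_one, one_mul]
    rfl
  · have := he (φ.symm f) (e.symm 0)
    rw [MulEquiv.apply_symm_apply, Equiv.apply_symm_apply, hf, mul_zero] at this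
    exact (Equiv.eq_symm_apply e).2 this

/-- Products of two involutions have no fixed points, so by planarity they lie in the translation
group `T`. All elements of `T` are of this form, so `T` is inverted by every involution, and all
involutions lie on one line. -/
theorem IsSharplyTwoTransitive.lineThrough_eq_of_isPlanar (hG : IsSharplyTwoTransitive G X)
    (hpl : NearField.IsPlanar K) (hc : CorrespondsToNearField (MulAction.toPermHom G X) K)
    (hfix : ¬ InvolutionsFixNoPoint G X) {i j : G} (hi : i ∈ involutions G)
    (hj : j ∈ involutions G) (hij : i ≠ j) :
    lineThrough (involutions G) i j = involutions G := by
  have hS := hG.sharpOnInvolutions hfix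
  obtain ⟨φ, e, he⟩ := hc
  let T : Subgroup G :=
    { carrier := {g | ∃ b : K, ∀ z, (φ g : Equiv.Perm K) z = b + z}
      one_mem' := ⟨0, fun z => by simp⟩
      mul_mem' := by
        rintro g h ⟨b, hb⟩ ⟨c, hc⟩
        exact ⟨b + c, fun z => by simp [hb, hc, add_assoc]⟩
      inv_mem' := by
        rintro g ⟨b, hb⟩
        refine ⟨-b, fun z => ?_⟩
        rw [map_inv, Subgroup.coe_inv, Equiv.Perm.inv_eq_iff_eq, hb, add_neg_cancel_left] }
  have hT : ∀ g, g ∈ T ↔ ∃ b : K, ∀ z, (φ g : Equiv.Perm K) z = b + z := fun g => Iff.rfl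
  have free : ∀ g ∈ T, ∀ x : X, g • x = x → g = 1 := by
    rintro g ⟨b, hb⟩ x hx
    have h1 := he g x
    rw [MulAction.toPermHom_apply, MulAction.toPerm_apply, hx, hb, eq_comm] at h1
    have hb0 : b = 0 := by simpa using h1
    have : φ g = 1 := Subtype.ext (Equiv.ext fun z => by rw [hb, hb0, zero_add]; rfl)
    simpa using this
  have prod : ∀ k ∈ involutions G, ∀ l ∈ involutions G, k * l ∈ T := by
    intro k hk l hl
    by_cases hkl : k = l
    · rw [hkl, hl.2]
      exact one_mem T
    obtain ⟨a, b, ha, hab⟩ := (φ (k * l)).2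
    have ha1 : a = 1 := by
      refine hpl.eq_one_of_forall_ne (b := b) fun z hz => ?_
      refine hG.mul_smul_ne hk hl hkl (e.symm z) ?_
      have h1 := he (k * l) (e.symm z)
      rw [Equiv.apply_symm_apply, hab, hz] at h1
      exact (Equiv.eq_symm_apply e).2 h1
    exact (hT _).2 ⟨b, fun z => by rw [hab, ha1, one_mul]⟩
  have inverts : ∀ t ∈ T, SemiconjBy i t t⁻¹ := by
    intro t ht
    obtain ⟨x, hx⟩ := hG.exists_fixedPoint hfix hi
    by_cases ht1 : t = 1
    · simp [ht1]
    have hne : x ≠ i • t • x := by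
      intro h
      refine ht1 (free t ht x ?_)
      have h2 := congrArg (fun y => i • y) h
      simp only [← mul_smul, hx, ← mul_assoc, hi.2, one_mul] at h2
      exact h2.symm
    -- The involution `m` swapping `x` and `i • t • x` satisfies `i * m = t`.
    obtain ⟨m, ⟨h1, h2⟩, -⟩ := hG.sharp x (i • t • x) (i • t • x) x hne hne.symm
    have hm : m ∈ involutions G := by
      refine ⟨?_, hG.eq_of_smul_eq hne (by rw [mul_smul, h1, h2, one_smul])
        (by rw [mul_smul, h2, h1, one_smul])⟩
      rintro rfl
      exact hne (by rwa [one_smul] at h1)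
    have h3 : t⁻¹ * (i * m) = 1 := by
      refine free _ (mul_mem (inv_mem ht) (prod i hi m hm)) x ?_
      rw [mul_smul, mul_smul, h1, ← mul_smul i i, hi.2, one_smul, inv_smul_smul]
    rw [inv_mul_eq_one.1 h3]
    exact semiconjBy_inv_mul hi hm
  have comm : ∀ s ∈ T, ∀ t ∈ T, Commute s t := by
    intro s hs t ht
    have h1 := (inverts s hs).mul_right (inverts t ht)
    have h2 : s⁻¹ * t⁻¹ = (s * t)⁻¹ :=
      mul_right_cancel (h1.eq.symm.trans (inverts _ (mul_mem hs ht)).eq)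
    rw [mul_inv_rev] at h2
    have h3 : Commute s⁻¹ t⁻¹ := h2
    simpa using h3.inv_left.inv_right
  ext k
  rw [hS.mem_lineThrough_iff hi hj hij]
  exact ⟨And.left, fun hk => ⟨hk, comm _ (prod i hi k hk) _ (prod i hi j hj)⟩⟩

theorem IsSharplyTwoTransitive.formsMockHyperbolic_of_isPlanar (hG : IsSharplyTwoTransitive G X)
    (hK : addOrderOf (1 : K) ≠ 2) (hpl : NearField.IsPlanar K)
    (hc : CorrespondsToNearField (MulAction.toPermHom G X) K) :
    FormsMockHyperbolic (involutions G) := by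
  have hfix := hc.not_involutionsFixNoPoint hK
  have hS := hG.sharpOnInvolutions hfix
  have hl : ∀ {i j : G}, i ∈ involutions G → j ∈ involutions G → i ≠ j →
      lineThrough (involutions G) i j = involutions G :=
    fun hi hj hij => hG.lineThrough_eq_of_isPlanar hpl hc hfix hi hj hij
  refine hS.formsMockHyperbolic_of_lines ?_ ?_
  · intro i hi j hj hij k hk l hk' hkl
    rw [hl hi hj hij, hl hk.1 hk'.1 hkl]
  · intro i hi j hj hij p hp q hq hpq h
    exact hS.conjSet_eq_of_mem hi hj hij (by rwa [hl hi hj hij])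

end SplitGroups

/-! ### Roots of translations -/

section Roots

variable {G : Type*} [Group G]

theorem mul_midpoint_mul_mul_midpoint {i j k : G} (hkj : k * i * k = j) :
    i * k * (i * k) = i * j := by
  rw [← hkj]
  simp only [mul_assoc]

/-- If translations have finite odd order, a root of a translation is a power of it. -/
theorem HasPermChar.centralizersContainRoots {X : Type*} [MulAction G X] {p : ℕ}
    (hp : HasPermChar G X p) (hp0 : p ≠ 0) (hp2 : p ≠ 2) : CentralizersContainRoots G := by
  obtain ⟨-, hp⟩ := hp.resolve_left fun h => hp2 h.2
  intro i hi j hj hij k hk hkj c hc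
  have hroot := mul_midpoint_mul_mul_midpoint hkj
  have hij1 := SharpOnInvolutions.mul_ne_one_of_ne hj hij
  have hik1 : i * k ≠ 1 := fun h => hij1 (by rw [← hroot, h, one_mul])
  have h1 := hp i hi j hj hij1
  have h2 := hp i hi k hk hik1
  rw [← hroot, ← pow_two, orderOf_pow' _ two_ne_zero, h2] at h1
  have hcop : (orderOf (i * k)).Coprime 2 := by
    rw [h2]
    have hdvd := Nat.gcd_dvd_left p 2
    have hpos : 0 < p.gcd 2 := Nat.gcd_pos_of_pos_right p two_pos
    have h3 := Nat.div_mul_cancel hdvd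
    rw [h1] at h3
    exact Nat.eq_of_mul_eq_mul_left (Nat.pos_of_ne_zero hp0) (h3.trans (mul_one p).symm)
  obtain ⟨m, hm⟩ := exists_pow_eq_self_of_coprime hcop.symm
  rw [← hm, pow_two, hroot]
  exact hc.pow_right m

namespace SharpOnInvolutions

/-- All triples consisting of two involutions and their midpoint are conjugate. Hence, if one
translation is not centralized by the centralizer of its square, then taking roots repeatedly gives
an infinite strictly descending chain of centralizers. -/
theorem exists_strictAnti_centralizer (hS : SharpOnInvolutions G)
    (h : ¬ CentralizersContainRoots G) :
    ∃ s : ℕ → G, StrictAnti fun n => Subgroup.centralizer {s n} := by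
  simp only [CentralizersContainRoots] at h
  push Not at h
  obtain ⟨i, hi, j, hj, hij, k, hk, hkj, c, hc, hck⟩ := h
  have hstep : ∀ l : {l : G // l ∈ involutions G ∧ i ≠ l},
      ∃ m : {l : G // l ∈ involutions G ∧ i ≠ l}, (m : G) * i * m = l := by
    rintro ⟨l, hl, hil⟩
    obtain ⟨m, hm, hml⟩ := hS.exists_swap hi hl hil
    refine ⟨⟨m, hm, ?_⟩, hml⟩
    rintro rfl
    exact hil (by rw [← hml, hi.2, one_mul])
  choose mid hmid using hstep
  refine ⟨fun n => i * (mid^[n] ⟨j, hj, hij⟩ : {l : G // l ∈ involutions G ∧ i ≠ l}),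
    strictAnti_nat_of_succ_lt fun n => ?_⟩
  beta_reduce
  rw [Function.iterate_succ_apply']
  set l := mid^[n] ⟨j, hj, hij⟩
  have hl := hmid l
  refine SetLike.lt_iff_le_and_exists.2 ⟨fun d hd => ?_, ?_⟩
  · rw [Subgroup.mem_centralizer_singleton_iff] at hd ⊢
    have hd' : Commute d (i * mid l) := hd
    rw [← mul_midpoint_mul_mul_midpoint hl]
    exact hd'.mul_right hd'
  · obtain ⟨g, g1, g2⟩ := hS.trans i hi j hj hij i hi l l.2.1 l.2.2
    have g3 : g * k * g⁻¹ = mid l := by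
      refine hS.eq_of_swap (conj_mem_involutions hk g) (mid l).2.1 hi l.2.1 l.2.2 ?_ hl
      nth_rewrite 1 [← g1]
      rw [conj_mul, conj_mul, hkj, g2]
    have g4 : i * l = g * (i * j) * g⁻¹ := by rw [← conj_mul, g1, g2]
    have g5 : i * mid l = g * (i * k) * g⁻¹ := by rw [← conj_mul, g1, g3]
    refine ⟨g * c * g⁻¹, ?_, ?_⟩
    · rw [Subgroup.mem_centralizer_singleton_iff, g4]
      exact (Commute.conj_iff g).2 hc
    · rw [Subgroup.mem_centralizer_singleton_iff, g5]
      exact fun h => hck ((Commute.conj_iff g).1 h)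

theorem centralizersContainRoots_of_dcc (hS : SharpOnInvolutions G) (hdcc : CentralizerDCC G) :
    CentralizersContainRoots G := by
  by_contra h
  obtain ⟨s, hs⟩ := hS.exists_strictAnti_centralizer h
  obtain ⟨n, hn⟩ := hdcc (fun n => {s n}) fun n => (hs (Nat.lt_succ_self n)).le
  exact (hs (Nat.lt_succ_self n)).ne (hn (n + 1) n.le_succ)

end SharpOnInvolutions

end Roots

/-! ### Planarity in finite Morley rank -/

section FiniteMorleyRank

variable {G : Type u} [Group G]

/-- The powers of an injective endomorphism that is not surjective have strictly decreasing
ranges. -/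
theorem strictAnti_range_pow_of_not_surjective {A : Type*} [Group A] (f : Monoid.End A)
    (hf : Function.Injective f) (hf' : ¬ Function.Surjective f) :
    StrictAnti fun n : ℕ => (MonoidHom.range (f ^ n : Monoid.End A) : Subgroup A) := by
  refine strictAnti_nat_of_succ_lt fun n => ?_
  have hn : Function.Injective (f ^ n : Monoid.End A) := by
    rw [Monoid.End.coe_pow]
    exact hf.iterate n
  have e : ∀ x, (f ^ (n + 1) : Monoid.End A) x = (f ^ n : Monoid.End A) (f x) := fun x => by
    rw [pow_succ]; rfl
  refine SetLike.lt_iff_le_and_exists.2 ⟨?_, ?_⟩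
  · rintro _ ⟨x, rfl⟩
    exact ⟨f x, (e x).symm⟩
  · rw [Function.Surjective] at hf'
    push Not at hf'
    obtain ⟨y, hy⟩ := hf'
    refine ⟨(f ^ n : Monoid.End A) y, ⟨y, rfl⟩, ?_⟩
    rintro ⟨x, hx⟩
    exact hy x (hn ((e x).symm.trans hx))

variable {L : FirstOrder.Language.{v, w}} [L.Structure G]

namespace SharpOnInvolutions

/-- The endomorphism is injective and definable, so the ranges of its powers form a descending chain
of definable subgroups. The chain would be strict if the endomorphism were not surjective. -/
theorem commutatorsSurjective_of_finiteMorleyRank (hS : SharpOnInvolutions G)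
    (hL : IsGroupOfFiniteMorleyRank L G) (hR : CentralizersContainRoots G) {i j : G}
    (hi : i ∈ involutions G) (hj : j ∈ involutions G) (hij : i ≠ j) :
    CommutatorsSurjective i j := by
  intro h hh hh1
  set A := Subgroup.centralizer {i * j}
  have hA : ∀ {x}, x ∈ A ↔ Commute x (i * j) := Subgroup.mem_centralizer_singleton_iff
  have hconj : ∀ {x}, x ∈ A → h * x * h⁻¹ ∈ A := fun hx =>
    hA.2 (hS.commute_conj_of_mem_normalizer hR hi hj hij (mem_pointStabilizer.1 hh).1 (hA.1 hx))
  have hcomm : ∀ {x y}, x ∈ A → y ∈ A → Commute x y := fun hx hy =>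
    hS.commute_of_commute hR hi hj hij (hA.1 hx) (hA.1 hy)
  let f : Monoid.End A := MonoidHom.mk'
    (fun x => ⟨x * (h * (x : G)⁻¹ * h⁻¹), mul_mem x.2 (hconj (inv_mem x.2))⟩) <| by
      rintro ⟨x, hx⟩ ⟨y, hy⟩
      refine Subtype.ext ?_
      have h1 := (hcomm (hconj (inv_mem hx)) (mul_mem hy (hconj (inv_mem hy)))).eq
      calc x * y * (h * (x * y)⁻¹ * h⁻¹)
          = x * (y * (h * y⁻¹ * h⁻¹) * (h * x⁻¹ * h⁻¹)) := by simp [mul_assoc]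
        _ = x * (h * x⁻¹ * h⁻¹) * (y * (h * y⁻¹ * h⁻¹)) := by
          rw [← h1, ← mul_assoc]
  have hf : ∀ x, (f x : G) = x * (h * (x : G)⁻¹ * h⁻¹) := fun x => rfl
  have hinj : Function.Injective f := by
    rw [injective_iff_map_eq_one]
    intro x hx
    by_contra hx1
    refine hh1 (hS.eq_one_of_mem_pointStabilizer hR hi hj hij hh (hA.1 x.2)
      (fun e => hx1 (Subtype.ext e)) ?_)
    have h1 : (x : G) * (h * (x : G)⁻¹ * h⁻¹) = 1 := congrArg Subtype.val hx
    have h2 : Commute h (x : G)⁻¹ := by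
      have h3 := inv_eq_of_mul_eq_one_right h1
      rw [Commute, SemiconjBy]
      nth_rewrite 2 [h3]
      simp
    simpa using h2.inv_right
  by_cases hsurj : Function.Surjective f
  · intro c hc
    obtain ⟨x, hx⟩ := hsurj ⟨c, hA.2 hc⟩
    exact ⟨x, hA.1 x.2, congrArg Subtype.val hx⟩
  · exfalso
    refine hL.not_strictAnti
      (H := fun n => (MonoidHom.range (f ^ n : Monoid.End A)).map A.subtype) ?_ ?_
    · intro n
      induction n with
      | zero =>
        convert hL.definable₁_centralizer (i * j) using 1
        ext x
        simp only [SetLike.mem_coe, Subgroup.mem_map]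
        constructor
        · rintro ⟨y, -, rfl⟩
          exact y.2
        · exact fun hx => ⟨⟨x, hx⟩, ⟨⟨x, hx⟩, rfl⟩, rfl⟩
      | succ n ih =>
        convert hL.definable₁_commutators ih h using 1
        have e : ∀ x, (f ^ (n + 1) : Monoid.End A) x = f ((f ^ n : Monoid.End A) x) := fun x => by
          rw [pow_succ']; rfl
        ext y
        simp only [SetLike.mem_coe, Subgroup.mem_map]
        constructor
        · rintro ⟨_, ⟨x, rfl⟩, rfl⟩
          exact ⟨_, ⟨_, ⟨x, rfl⟩, rfl⟩, (congrArg Subtype.val (e x)).symm⟩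
        · rintro ⟨_, ⟨_, ⟨x, rfl⟩, rfl⟩, rfl⟩
          exact ⟨_, ⟨x, rfl⟩, congrArg Subtype.val (e x)⟩
    · exact fun m n hmn => Subgroup.map_subtype_lt_map_subtype.2
        (strictAnti_range_pow_of_not_surjective f hinj hsurj hmn)

theorem centralizersContainRoots_of_finiteMorleyRank (hS : SharpOnInvolutions G)
    (hL : IsGroupOfFiniteMorleyRank L G) : CentralizersContainRoots G := by
  by_contra h
  obtain ⟨s, hs⟩ := hS.exists_strictAnti_centralizer h
  exact hL.not_strictAnti (fun n => hL.definable₁_centralizer (s n)) hs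

end SharpOnInvolutions

end FiniteMorleyRank

theorem mainTheorem7 {G : Type u} {X : Type v} [Group G] [MulAction G X]
    (hG : IsSharplyTwoTransitive G X) :
    (∀ (K : Type w) [NearField K], addOrderOf (1 : K) ≠ 2 → NearField.IsPlanar K →
      CorrespondsToNearField (MulAction.toPermHom G X) K →
      FormsMockHyperbolic (involutions G)) ∧
    (∀ p : ℕ, p ≠ 0 → p ≠ 2 → HasPermChar G X p → MaximalNearFieldIsPlanar G →
      FormsMockHyperbolic (involutions G)) ∧
    (HasPermChar G X 0 → CentralizerDCC G → MaximalNearFieldIsPlanar G →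
      FormsMockHyperbolic (involutions G)) ∧
    (∀ (L : FirstOrder.Language.{a, b}) [L.Structure G], ¬ HasPermChar G X 2 →
      IsGroupOfFiniteMorleyRank L G → FormsMockHyperbolic (involutions G)) := by
  refine ⟨fun K _ hK hpl hc => hG.formsMockHyperbolic_of_isPlanar hK hpl hc, ?_, ?_, ?_⟩
  · intro p hp0 hp2 hp hpl
    have hS := hG.sharpOnInvolutions (hp.resolve_left fun h => hp2 h.2).1
    have hR := hp.centralizersContainRoots hp0 hp2
    exact hS.formsMockHyperbolic hR fun i hi j hj hij =>
      hS.commutatorsSurjective_of_isPlanar hR hi hj hij hpl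
  · intro hp hdcc hpl
    have hS := hG.sharpOnInvolutions (hp.resolve_left fun h => two_ne_zero h.2.symm).1
    have hR := hS.centralizersContainRoots_of_dcc hdcc
    exact hS.formsMockHyperbolic hR fun i hi j hj hij =>
      hS.commutatorsSurjective_of_isPlanar hR hi hj hij hpl
  · intro L _ hp hL
    have hS := hG.sharpOnInvolutions fun h => hp (Or.inl ⟨h, rfl⟩)
    have hR := hS.centralizersContainRoots_of_finiteMorleyRank hL
    exact hS.formsMockHyperbolic hR fun i hi j hj hij =>
      hS.commutatorsSurjective_of_finiteMorleyRank hL hR hi hj hij
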